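/- **Setting.** Let $M,K,R\ge 1$ be integers, $T=KR$, and $H,B>0$, $Q,\tau,\zeta,\sigma_2,\sigma_4\ge 0$. A problem instance on $\mathbb R^d$ consists of differentiable objectives $F_1,\dots,F_M:\mathbb R^d\to\mathbb R$ with average $F=\frac1M\sum_m F_m$, probability distributions $\mathcal D_1,\dots,\mathcal D_M$, and for each machine $m$ a stochastic first-order oracle, which at $x$ draws $z\sim\mathcal D_m$ and returns a value $s^m_z(x)$ and a gradient $g^m_z(x)$ with expectations $F_m(x)$ and $\nabla F_m(x)$. (For a loss $f$: $F_m=\mathbb E_{z\sim\mathcal D_m}f(\cdot;z)$ and $g^m_z=\nabla f(\cdot;z)$.) Write $S^\star=\arg\min F$. Assume, for all $m,n\in[M]$ and $x,y\in\mathbb R^d$: 1. (convexity) $F_m(x)+\langle\nabla F_m(x),y-x\rangle\le F_m(y)$; 2. (second-order smoothness) $F_m(y)\le F_m(x)+\langle\nabla F_m(x),y-x\rangle+\frac H2\|x-y\|^2$; 3. (third-order smoothness) $F_m$ is $C^2$ and $\|\nabla^2F_m(x)-\nabla^2F_m(y)\|\le Q\|x-y\|$; 4. (second moment) $\mathbb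 E_{z\sim\mathcal D_m}\|g^m_z(x)-\nabla F_m(x)\|^2\le\sigma_{2,m}^2$, where $\frac1M\sum_m\sigma_{2,m}^2=\sigma_2^2$; 5. (fourth moment) $\mathbb E_{z\sim\mathcal D_m}\|g^m_z(x)-\nabla F_m(x)\|^4\le\sigma_{4,m}^4$, where $\frac1M\sum_m\sigma_{4,m}^4=\sigma_4^4$; 6. (bounded optima) every $F_m$ has a minimizer, and $F$ has a minimizer of norm at most $B$; 7. (second-order heterogeneity) $\|\nabla^2F_m(x)-\nabla^2F_n(x)\|\le\tau$; 8. (uniform first-order heterogeneity) $\|\nabla F_m(x)-\nabla F_n(x)\|\le H\zeta$. **Algorithm.** For $\mu>0$ let $F_{m,\mu}(x)=F_m(x)+\frac\mu2\|x\|^2$, with stochastic gradients $g^m_z(x)+\mu x$. Local SGD on the regularized problem with step-size $\eta$ starts at $x_0^m=0$ and uses independent samples $z_t^m\sim\mathcal D_m$, $0\le t<T$, $m\in[M]$. With $y_{t+1}^m=x_t^m-\eta\,(g^m_{z_t^m}(x_t^m)+\mu x_t^m)$ it sets $x_{t+1}^m=y_{t+1}^m$ if $K\nmid t+1$, and $x_{t+1}^m=\frac1M\sum_n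 y_{t+1}^n$ if $K\mid t+1$. Let $x_t=\frac1M\sum_m x_t^m$ and $$\hat x=\frac1W\sum_{t=0}^{T-1}w_tx_t,\qquad w_t=\Big(1-\frac{\eta\mu}2\Big)^{T-1-t},\qquad W=\sum_{t=0}^{T-1}w_t .$$ **Theorem.** There are universal constants $c,C>0$ such that for all $M,K,R,H,B,Q,\tau,\zeta,\sigma_2,\sigma_4$ as above with $$R\ \ge\ c\left(\frac1K+\frac{\sigma_2^2}{H^2B^2MK}+\frac{\tau\zeta}{BH}+\frac{Q\zeta^2}{HB}+\frac{\tau\sigma_2}{H^2B\sqrt K}+\frac{\sigma_2Q^{1/2}}{H^{3/2}\sqrt{BK}}+\frac{Q^{1/2}\sigma_4}{H^{3/2}\sqrt B\,K^{3/4}}\right)$$ there are a step-size $\eta>0$ and a regularization strength $\mu>0$ with $\eta\mu<2$, depending only on these parameters, such that for every dimension $d$, every problem instance satisfying 1–8, and every $x^\star\in S^\star$, $F(\hat x)$ is integrable and $$\begin{aligned}\mathbb E[F(\hat x)]-F(x^\star)\ \le\ C\,(1+\ln(KR))\bigg(&\frac{HB^2}{KR}+\frac{\tau^{1/2}H^{1/2}\zeta^{1/2}B^{3/2}}{R^{1/2}}+\frac{\tau^{1/2}\sigma_2^{1/2}B^{3/2}}{K^{1/4}R^{1/2}}+\frac{Q^{1/3}B^{5/3}H^{2/3}\zeta^{2/3}}{R^{2/3}}\\&+\frac{Q^{1/3}B^{5/3}\sigma_2^{2/3}}{K^{1/3}R^{2/3}}+\frac{Q^{1/3}B^{5/3}\sigma_4^{2/3}}{K^{1/2}R^{2/3}}+\frac{\sigma_2B}{\sqrt{MKR}}\bigg).\end{aligned}$$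 -/

import Mathlib

open MeasureTheory ProbabilityTheory Gradient

/-- The space `ℝ^d` with its Euclidean norm and inner product. -/
abbrev Vec (d : ℕ) : Type := EuclideanSpace ℝ (Fin d)

/-- A distributed stochastic optimization problem on `ℝ^d` with `M` machines and data space `Z`.
Machine `m` has a differentiable objective `F m`, a data distribution `dist m`, and a stochastic
first-order oracle: at the point `x` it draws `z ∼ dist m` and returns the pair
`(val m x z, grad m x z)`, whose expectation is `(F m x, ∇ (F m) x)`.
The choice `val m x z = f (x; z)`, `grad m x z = ∇ₓ f (x; z)`, `F m x = 𝔼 f (x; z)`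
is the case of a loss function `f`. -/
structure FedProblem (d M : ℕ) (Z : Type*) [MeasurableSpace Z] where
  dist : Fin M → Measure Z
  isProb : ∀ m, IsProbabilityMeasure (dist m)
  F : Fin M → Vec d → ℝ
  differentiable : ∀ m, Differentiable ℝ (F m)
  val : Fin M → Vec d → Z → ℝ
  grad : Fin M → Vec d → Z → Vec d
  integrable_val : ∀ m x, Integrable (val m x) (dist m)
  integral_val : ∀ m x, ∫ z, val m x z ∂(dist m) = F m x
  measurable_grad : ∀ m, Measurable fun p : Vec d × Z => grad m p.1 p.2
  integrable_grad : ∀ m x, Integrable (grad m x) (dist m)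
  integral_grad : ∀ m x, ∫ z, grad m x z ∂(dist m) = ∇ (F m) x

/-- The iterates `x_t^m` of (vanilla) Local SGD started at `0`, with step-size `η`, `K` local steps
per communication round, stochastic gradients `g m x z`, and samples `z t m` drawn at time `t` on
machine `m`: every machine makes an SGD step, and the results are averaged over the machines
whenever `t + 1` is a multiple of `K`. -/
noncomputable def localSGD {d M : ℕ} {Z : Type*} (g : Fin M → Vec d → Z → Vec d) (η : ℝ) (K : ℕ)
    (z : ℕ → Fin M → Z) : ℕ → Fin M → Vec d
  | 0 => fun _ => 0
  | t + 1 => fun m =>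
      if (t + 1) % K = 0 then
        (1 / (M : ℝ)) • ∑ n, (localSGD g η K z t n - η • g n (localSGD g η K z t n) (z t n))
      else
        localSGD g η K z t m - η • g m (localSGD g η K z t m) (z t m)

namespace FedProblem

variable {d M : ℕ} {Z : Type*} [MeasurableSpace Z] (P : FedProblem d M Z)

/-- The average objective `F = (1/M) ∑ₘ F_m`. -/
noncomputable def avg (x : Vec d) : ℝ := (1 / (M : ℝ)) * ∑ m, P.F m x

/-- The set `S_m⋆` of minimizers of the objective of machine `m`. -/
def optimaOf (m : Fin M) : Set (Vec d) := {x | ∀ y, P.F m x ≤ P.F m y}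

/-- The set `S⋆` of minimizers of the average objective. -/
def optima : Set (Vec d) := {x | ∀ y, P.avg x ≤ P.avg y}

/-- The Hessian `∇² F_m (x)`, as a linear map; its norm is the spectral norm. -/
noncomputable def hessian (m : Fin M) (x : Vec d) : Vec d →L[ℝ] Vec d :=
  fderiv ℝ (∇ (P.F m)) x

/-- Convexity of all objectives. -/
def Convex : Prop :=
  ∀ m x y, P.F m x + inner ℝ (∇ (P.F m) x) (y - x) ≤ P.F m y

/-- Second-order smoothness of all objectives, with constant `H`. -/
def SecondOrderSmooth (H : ℝ) : Prop :=
  ∀ m x y, P.F m y ≤ P.F m x + inner ℝ (∇ (P.F m) x) (y - x) + H / 2 * ‖x - y‖ ^ 2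

/-- Third-order smoothness of all objectives: twice continuously differentiable, with a
`Q`-Lipschitz Hessian. -/
def ThirdOrderSmooth (Q : ℝ) : Prop :=
  ∀ m, ContDiff ℝ 2 (P.F m) ∧ ∀ x y, ‖P.hessian m x - P.hessian m y‖ ≤ Q * ‖x - y‖

/-- The gradient noise of machine `m` has second moment at most `s m ^ 2` at every point, where
the `s m ^ 2` have average `σ₂ ^ 2`. -/
def BoundedSecondMoment (σ₂ : ℝ) : Prop :=
  ∃ s : Fin M → ℝ, (∀ m, 0 ≤ s m) ∧ (1 / (M : ℝ)) * ∑ m, s m ^ 2 = σ₂ ^ 2 ∧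
    ∀ m x, Integrable (fun z => ‖P.grad m x z - ∇ (P.F m) x‖ ^ 2) (P.dist m) ∧
      ∫ z, ‖P.grad m x z - ∇ (P.F m) x‖ ^ 2 ∂(P.dist m) ≤ s m ^ 2

/-- The gradient noise of machine `m` has fourth moment at most `s m ^ 4` at every point, where
the `s m ^ 4` have average `σ₄ ^ 4`. -/
def BoundedFourthMoment (σ₄ : ℝ) : Prop :=
  ∃ s : Fin M → ℝ, (∀ m, 0 ≤ s m) ∧ (1 / (M : ℝ)) * ∑ m, s m ^ 4 = σ₄ ^ 4 ∧
    ∀ m x, Integrable (fun z => ‖P.grad m x z - ∇ (P.F m) x‖ ^ 4) (P.dist m) ∧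
      ∫ z, ‖P.grad m x z - ∇ (P.F m) x‖ ^ 4 ∂(P.dist m) ≤ s m ^ 4

/-- Bounded optima: every machine has a minimizer (with some norm bound `B_m`), and the average
objective has a minimizer of norm at most `B`. -/
def BoundedOptima (B : ℝ) : Prop :=
  (∀ m, ∃ Bm : ℝ, ∃ x ∈ P.optimaOf m, ‖x‖ ≤ Bm) ∧ ∃ x ∈ P.optima, ‖x‖ ≤ B

/-- Second-order heterogeneity at most `τ`. -/
def SecondOrderHeterogeneity (τ : ℝ) : Prop :=
  ∀ m n x, ‖P.hessian m x - P.hessian n x‖ ≤ τ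

/-- Uniform first-order heterogeneity at most `H ζ`. -/
def UniformFirstOrderHeterogeneity (H ζ : ℝ) : Prop :=
  ∀ m n x, ‖∇ (P.F m) x - ∇ (P.F n) x‖ ≤ H * ζ

/-- The samples `z t m` are independent over all times `t` and machines `m`, and `z t m` has
law `dist m`. -/
structure IsSampling {Ω : Type*} [MeasurableSpace Ω] (ν : Measure Ω)
    (z : ℕ → Fin M → Ω → Z) : Prop where
  measurable : ∀ t m, Measurable (z t m)
  law : ∀ t m, ν.map (z t m) = P.dist m
  indep : iIndepFun (fun p : ℕ × Fin M => z p.1 p.2) ν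

theorem hasGradientAt_regularized {f : Vec d → ℝ} (hf : Differentiable ℝ f) (μ : ℝ) (x : Vec d) :
    HasGradientAt (fun y => f y + μ / 2 * ‖y‖ ^ 2) (∇ f x + μ • x) x := by
  rw [hasGradientAt_iff_hasFDerivAt]
  have h1 : HasFDerivAt f (InnerProductSpace.toDual ℝ (Vec d) (∇ f x)) x :=
    ((hf x).hasGradientAt).hasFDerivAt
  have h2 := ((hasStrictFDerivAt_norm_sq x).hasFDerivAt).const_mul (μ / 2)
  refine (h1.add h2).congr_fderiv ?_
  ext v
  simp
  ring

/-- The `ℓ²`-regularized problem, with objectives `F_m(x) + (μ/2) ‖x‖²` and the corresponding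
oracles. -/
noncomputable def regularize (μ : ℝ) : FedProblem d M Z where
  dist := P.dist
  isProb := P.isProb
  F m x := P.F m x + μ / 2 * ‖x‖ ^ 2
  differentiable m x := (hasGradientAt_regularized (P.differentiable m) μ x).differentiableAt
  val m x z := P.val m x z + μ / 2 * ‖x‖ ^ 2
  grad m x z := P.grad m x z + μ • x
  integrable_val m x := by
    have := P.isProb m
    exact (P.integrable_val m x).add (integrable_const _)
  integral_val m x := by
    have := P.isProb m
    rw [integral_add (P.integrable_val m x) (integrable_const _), P.integral_val]
    simp
  measurable_grad m := (P.measurable_grad m).add (measurable_fst.const_smul μ)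
  integrable_grad m x := by
    have := P.isProb m
    exact (P.integrable_grad m x).add (integrable_const _)
  integral_grad m x := by
    have := P.isProb m
    rw [integral_add (P.integrable_grad m x) (integrable_const _), P.integral_grad,
      (hasGradientAt_regularized (P.differentiable m) μ x).gradient]
    simp

/-- The averaged iterate `x_t = (1/M) ∑ₘ x_t^m` of Local SGD on the problem `P`. -/
noncomputable def avgIterate (η : ℝ) (K : ℕ) (z : ℕ → Fin M → Z) (t : ℕ) : Vec d :=
  (1 / (M : ℝ)) • ∑ m, localSGD P.grad η K z t m

/-- The weighted iterate `x̂ = (1/W) ∑_{t < T} w_t x_t` of Local SGD on the problem `P`, with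
`w_t = (1 - η μ / 2)^(T - 1 - t)` and `W = ∑_{t < T} w_t`, where `T = K R`. -/
noncomputable def weightedIterate (η μ : ℝ) (K R : ℕ) (z : ℕ → Fin M → Z) : Vec d :=
  (1 / ∑ t ∈ Finset.range (K * R), (1 - η * μ / 2) ^ (K * R - 1 - t)) •
    ∑ t ∈ Finset.range (K * R), (1 - η * μ / 2) ^ (K * R - 1 - t) • P.avgIterate η K z t

end FedProblem

/-! Regularization by `μ/2 ‖x‖²` makes the averaged iterate contract by `1 - ημ/2` per step
towards a minimizer of `F`, at the cost of `μ‖x⋆‖²`. The remaining error of a step is the noise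
`η²σ₂²/M` of the averaged gradient and the bias of evaluating the gradients at the local iterates
instead of at their mean. Since the deviations from the mean sum to zero, the part of this bias
that is linear in them only sees the differences of the Hessians, which `τ` bounds; the quadratic
part is bounded by `Q`. So the bias is controlled by the second and fourth moments of the
dispersion of the local iterates: a gradient step on one common convex smooth objective does not
increase the dispersion, hence heterogeneity and noise let its moments grow by at most a factor of
order `1 + 1/K` plus a drift term per local step, and every communication resets them to zero.
Weighting the iterates by powers of `1 - ημ/2` telescopes the recurrence, and for `η = 1/(8μKR)`
the choice `μ = rate / B²` balances all the error terms against the rate.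
-/

open scoped BigOperators

section Young

theorem add_sq_le_young (a b : ℝ) {κ : ℝ} (hκ : 0 < κ) :
    (a + b) ^ 2 ≤ (1 + 1 / κ) * a ^ 2 + (1 + κ) * b ^ 2 := by
  have gap : (1 + 1 / κ) * a ^ 2 + (1 + κ) * b ^ 2 - (a + b) ^ 2 = (a - κ * b) ^ 2 / κ := by
    field_simp
    ring
  have gap_nonneg : 0 ≤ (a - κ * b) ^ 2 / κ := by positivity
  linarith

theorem norm_add_sq_le_two_mul {E : Type*} [SeminormedAddCommGroup E] (x y : E) :
    ‖x + y‖ ^ 2 ≤ 2 * ‖x‖ ^ 2 + 2 * ‖y‖ ^ 2 := by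
  have h := add_sq_le (a := ‖x‖) (b := ‖y‖)
  have htri := pow_le_pow_left₀ (norm_nonneg (x + y)) (norm_add_le x y) 2
  linarith

theorem neg_two_mul_inner_le {E : Type*} [SeminormedAddCommGroup E] [InnerProductSpace ℝ E]
    (x y : E) {c : ℝ} (hc : 0 < c) :
    -(2 * inner ℝ x y) ≤ c * ‖x‖ ^ 2 + ‖y‖ ^ 2 / c := by
  have square : ‖c • x + y‖ ^ 2 / c = c * ‖x‖ ^ 2 + 2 * inner ℝ x y + ‖y‖ ^ 2 / c := by
    rw [norm_add_sq_real, norm_smul, real_inner_smul_left, Real.norm_of_nonneg hc.le]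
    field_simp
  have square_nonneg : 0 ≤ ‖c • x + y‖ ^ 2 / c := by positivity
  linarith

end Young

section SmoothConvex

variable {E : Type*} [NormedAddCommGroup E] [InnerProductSpace ℝ E]

/-- `f` lies above the affine functions `y ↦ f x + ⟪g x, y - x⟫`: convexity in first-order form,
where `g` plays the role of the gradient of `f` (or of a selection of subgradients). -/
def FirstOrderConvex (f : E → ℝ) (g : E → E) : Prop :=
  ∀ x y, f x + inner ℝ (g x) (y - x) ≤ f y

/-- `f` lies below its quadratic models with curvature `H`: `H`-smoothness in first-order form,
where `g` plays the role of the gradient of `f`. -/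
def FirstOrderSmooth (H : ℝ) (f : E → ℝ) (g : E → E) : Prop :=
  ∀ x y, f y ≤ f x + inner ℝ (g x) (y - x) + H / 2 * ‖x - y‖ ^ 2

variable {f : E → ℝ} {g : E → E} {H : ℝ}

theorem FirstOrderConvex.convexOn (hf : FirstOrderConvex f g) : ConvexOn ℝ Set.univ f := by
  refine ⟨convex_univ, fun x _ y _ a b ha hb hab => ?_⟩
  set c := a • x + b • y
  have hx := mul_le_mul_of_nonneg_left (hf c x) ha
  have hy := mul_le_mul_of_nonneg_left (hf c y) hb
  have cancel : a * inner ℝ (g c) (x - c) + b * inner ℝ (g c) (y - c) = 0 := by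
    rw [← real_inner_smul_right, ← real_inner_smul_right, ← inner_add_right]
    have : a • (x - c) + b • (y - c) = c - (a + b) • c := by
      simp only [c]
      module
    rw [this, hab, one_smul, sub_self, inner_zero_right]
  have hc : f c = a * f c + b * f c := by rw [← add_mul, hab, one_mul]
  simp only [smul_eq_mul]
  linarith

theorem FirstOrderSmooth.norm_sq_le_of_forall_le (hf : FirstOrderSmooth H f g) (hH : 0 < H)
    {b : ℝ} (hb : ∀ y, b ≤ f y) (x : E) : ‖g x‖ ^ 2 ≤ 2 * H * (f x - b) := by
  have descent := hf x (x - (1 / H) • g x)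
  rw [sub_sub_cancel, sub_sub_cancel_left, inner_neg_right, real_inner_smul_right,
    real_inner_self_eq_norm_sq, norm_smul, Real.norm_of_nonneg (by positivity)] at descent
  have model_min : -(1 / H * ‖g x‖ ^ 2) + H / 2 * (1 / H * ‖g x‖) ^ 2 = -(‖g x‖ ^ 2 / (2 * H)) := by
    field_simp
    ring
  have : ‖g x‖ ^ 2 / (2 * H) ≤ f x - b := by linarith [hb (x - (1 / H) • g x)]
  rwa [div_le_iff₀ (by positivity), mul_comm] at this

theorem FirstOrderSmooth.sub_inner (hf : FirstOrderSmooth H f g) (v : E) :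
    FirstOrderSmooth H (fun x => f x - inner ℝ v x) (fun x => g x - v) := fun x y => by
  have h := hf x y
  simp only [inner_sub_left, inner_sub_right] at h ⊢
  linarith

/-- Subtracting `⟪g y, ·⟫` turns `y` into a minimizer without affecting smoothness. -/
theorem FirstOrderConvex.norm_sub_sq_le (hconv : FirstOrderConvex f g)
    (hsmooth : FirstOrderSmooth H f g) (hH : 0 < H) (x y : E) :
    ‖g x - g y‖ ^ 2 ≤ 2 * H * (f x - f y - inner ℝ (g y) (x - y)) := by
  have hmin : ∀ u, f y - inner ℝ (g y) y ≤ f u - inner ℝ (g y) u := fun u => by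
    have h := hconv y u
    rw [inner_sub_right] at h
    linarith
  have h := (hsmooth.sub_inner (g y)).norm_sq_le_of_forall_le hH hmin x
  rw [inner_sub_right]
  exact h.trans_eq (by ring)

theorem FirstOrderConvex.cocoercive (hconv : FirstOrderConvex f g)
    (hsmooth : FirstOrderSmooth H f g) (hH : 0 < H) (x y : E) :
    ‖g x - g y‖ ^ 2 ≤ H * inner ℝ (g x - g y) (x - y) := by
  have hxy := hconv.norm_sub_sq_le hsmooth hH x y
  have hyx := hconv.norm_sub_sq_le hsmooth hH y x
  rw [norm_sub_rev (g y), ← neg_sub x y, inner_neg_right] at hyx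
  rw [inner_sub_left]
  linarith

theorem FirstOrderConvex.norm_damped_step_sub_le (hconv : FirstOrderConvex f g)
    (hsmooth : FirstOrderSmooth H f g) (hH : 0 < H) {η a : ℝ} (hη : 0 ≤ η) (ha₀ : 0 ≤ a)
    (ha₁ : a ≤ 1) (hηH : η * H ≤ 2 * a) (x y : E) :
    ‖(a • x - η • g x) - (a • y - η • g y)‖ ≤ ‖x - y‖ := by
  have hco := hconv.cocoercive hsmooth hH x y
  have regroup : (a • x - η • g x) - (a • y - η • g y) = a • (x - y) - η • (g x - g y) := by
    module
  rw [regroup, ← sq_le_sq₀ (norm_nonneg _) (norm_nonneg _), norm_sub_sq_real, norm_smul,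
    norm_smul, Real.norm_of_nonneg ha₀, Real.norm_of_nonneg hη, real_inner_smul_left,
    real_inner_smul_right, real_inner_comm]
  set q : ℝ := inner ℝ (g x - g y) (x - y)
  have hq : 0 ≤ q := nonneg_of_mul_nonneg_right ((sq_nonneg _).trans hco) hH
  have hgrad : η ^ 2 * ‖g x - g y‖ ^ 2 ≤ η * q * (2 * a) := calc
    η ^ 2 * ‖g x - g y‖ ^ 2 ≤ η ^ 2 * (H * q) := by gcongr
    _ = η * q * (η * H) := by ring
    _ ≤ η * q * (2 * a) := by gcongr
  have hdamp : a ^ 2 * ‖x - y‖ ^ 2 ≤ ‖x - y‖ ^ 2 :=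
    mul_le_of_le_one_left (sq_nonneg _) (pow_le_one₀ ha₀ ha₁)
  linarith

theorem neg_two_mul_inner_sub_add_smul_le (hconv : FirstOrderConvex f g) (w y : E) (μ : ℝ) :
    -(2 * inner ℝ (w - y) (g w + μ • w))
      ≤ -(2 * (f w - f y)) - μ * ‖w - y‖ ^ 2 - μ * ‖w‖ ^ 2 + μ * ‖y‖ ^ 2 := by
  have hsub := hconv w y
  rw [← neg_sub w y, inner_neg_right, real_inner_comm] at hsub
  have polarization := norm_sub_sq_real (w - y) w
  rw [sub_sub_cancel_left, norm_neg] at polarization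
  have hreg : 2 * (μ * inner ℝ (w - y) w) = μ * (‖w - y‖ ^ 2 + ‖w‖ ^ 2 - ‖y‖ ^ 2) := by
    rw [polarization]
    ring
  rw [inner_add_right, real_inner_smul_right]
  linarith

theorem FirstOrderSmooth.sub_le_of_forall_le (hf : FirstOrderSmooth H f g) (hH : 0 < H) {y : E}
    (hy : ∀ x, f y ≤ f x) (x : E) : f x - f y ≤ H / 2 * ‖x - y‖ ^ 2 := by
  have hgrad : g y = 0 := by
    simpa using hf.norm_sq_le_of_forall_le hH hy y
  have h := hf y x
  rw [hgrad, inner_zero_left, norm_sub_rev] at h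
  linarith

/-- The minimizer of `f` rather than of the regularized objective is used as a reference point, at
the price of the term `η * μ * ‖y‖ ^ 2`. -/
theorem norm_inexact_regularized_step_sub_sq_le (hconv : FirstOrderConvex f g)
    (hsmooth : FirstOrderSmooth H f g) (hH : 0 < H) {η μ : ℝ} (hη : 0 < η) (hμ : 0 < μ)
    (hημ : η * μ ≤ 1 / 4) (hηH : 8 * (η * H) ≤ 1) {y : E} (hy : ∀ x, f y ≤ f x) (w e : E) :
    ‖w - η • (g w + μ • w + e) - y‖ ^ 2 ≤ (1 - η * μ / 2) * ‖w - y‖ ^ 2 - η * (f w - f y)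
      + η * μ * ‖y‖ ^ 2 + 3 * η / μ * ‖e‖ ^ 2 := by
  have hgap : 0 ≤ f w - f y := sub_nonneg.2 (hy w)
  have hgrad := hsmooth.norm_sq_le_of_forall_le hH hy w
  have hdescent := mul_le_mul_of_nonneg_left (neg_two_mul_inner_sub_add_smul_le hconv w y μ) hη.le
  have hbias := mul_le_mul_of_nonneg_left
    (neg_two_mul_inner_le (w - y) e (show 0 < μ / 2 by positivity)) hη.le
  have hstep : ‖g w + μ • w + e‖ ^ 2
      ≤ 8 * H * (f w - f y) + 4 * μ ^ 2 * ‖w‖ ^ 2 + 2 * ‖e‖ ^ 2 := by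
    have h₁ := norm_add_sq_le_two_mul (g w + μ • w) e
    have h₂ := norm_add_sq_le_two_mul (g w) (μ • w)
    rw [norm_smul, mul_pow, Real.norm_of_nonneg hμ.le] at h₂
    linarith
  have hstep_le : η ^ 2 * ‖g w + μ • w + e‖ ^ 2
      ≤ η * (f w - f y) + η * μ * ‖w‖ ^ 2 + η / μ * ‖e‖ ^ 2 := calc
    _ ≤ η ^ 2 * (8 * H * (f w - f y) + 4 * μ ^ 2 * ‖w‖ ^ 2 + 2 * ‖e‖ ^ 2) := by gcongr
    _ = 8 * (η * H) * (η * (f w - f y)) + 4 * (η * μ) * (η * μ * ‖w‖ ^ 2)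
        + 2 * (η * μ) * (η / μ * ‖e‖ ^ 2) := by
      field_simp
    _ ≤ 1 * (η * (f w - f y)) + 1 * (η * μ * ‖w‖ ^ 2) + 1 * (η / μ * ‖e‖ ^ 2) := by
      gcongr <;> linarith
    _ = _ := by ring
  have expand : ‖w - η • (g w + μ • w + e) - y‖ ^ 2 = ‖w - y‖ ^ 2
      + η * -(2 * inner ℝ (w - y) (g w + μ • w)) + η * -(2 * inner ℝ (w - y) e)
      + η ^ 2 * ‖g w + μ • w + e‖ ^ 2 := by
    rw [sub_right_comm, norm_sub_sq_real, real_inner_smul_right, norm_smul, mul_pow,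
      Real.norm_of_nonneg hη.le, inner_add_right (w - y) _ e]
    ring
  have hbias_eq : ‖e‖ ^ 2 / (μ / 2) * η + η / μ * ‖e‖ ^ 2 = 3 * η / μ * ‖e‖ ^ 2 := by
    field_simp
    ring
  rw [expand]
  linarith

end SmoothConvex

section Dispersion

open Fintype (balance balance_apply)

variable {ι : Type*} [Fintype ι]

theorem expect_eq_one_div_card_smul_sum {V : Type*} [AddCommGroup V] [Module ℝ V] [Module ℚ≥0 V]
    (x : ι → V) : 𝔼 i, x i = (1 / Fintype.card ι : ℝ) • ∑ i, x i := by
  rw [Finset.expect, ← NNRat.cast_smul_eq_nnqsmul ℝ]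
  simp

theorem continuous_expect {V : Type*} [AddCommGroup V] [Module ℝ V] [Module ℚ≥0 V]
    [TopologicalSpace V] [ContinuousAdd V] [ContinuousConstSMul ℝ V] :
    Continuous fun x : ι → V => 𝔼 i, x i := by
  simp only [expect_eq_one_div_card_smul_sum]
  fun_prop

variable {E : Type*} [NormedAddCommGroup E] [Module ℚ≥0 E]

theorem norm_expect_le [NormedSpace ℝ E] (x : ι → E) : ‖𝔼 i, x i‖ ≤ 𝔼 i, ‖x i‖ :=
  Finset.le_expect_of_subadditive norm_zero norm_add_le fun n v => by
    rw [← NNRat.cast_smul_eq_nnqsmul ℝ, ← NNRat.cast_smul_eq_nnqsmul ℝ, norm_smul]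
    simp

/-- The mean square deviation of a finite family of vectors from its mean. -/
noncomputable def dispersion (x : ι → E) : ℝ := 𝔼 i, ‖balance x i‖ ^ 2

theorem dispersion_nonneg (x : ι → E) : 0 ≤ dispersion x :=
  Finset.expect_nonneg fun _ _ => sq_nonneg _

theorem dispersion_const [Nonempty ι] (c : E) : dispersion (fun _ : ι => c) = 0 := by
  simp [dispersion, balance_apply]

theorem continuous_dispersion [NormedSpace ℝ E] : Continuous (dispersion : (ι → E) → ℝ) := by
  have hmean := continuous_expect (ι := ι) (V := E)
  unfold dispersion
  simp only [balance_apply]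
  exact continuous_expect.comp (by fun_prop)

variable [InnerProductSpace ℝ E]

/-- The covariance of two finite families of vectors under the uniform distribution on the
indices. Centering one of the two families suffices. -/
noncomputable def familyCovariance (x y : ι → E) : ℝ := 𝔼 i, inner ℝ (balance x i) (y i)

theorem inner_expect_right (v : E) (x : ι → E) : inner ℝ v (𝔼 i, x i) = 𝔼 i, inner ℝ v (x i) :=
  map_expect ((innerₗ E v).restrictScalars ℚ≥0) x _

theorem inner_expect_left (v : E) (x : ι → E) : inner ℝ (𝔼 i, x i) v = 𝔼 i, inner ℝ (x i) v := by
  simp only [real_inner_comm v, inner_expect_right]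

theorem expect_norm_sub_sq [Nonempty ι] (x : ι → E) (c : E) :
    𝔼 i, ‖x i - c‖ ^ 2 = dispersion x + ‖𝔼 i, x i - c‖ ^ 2 := by
  have split : ∀ i, ‖x i - c‖ ^ 2
      = ‖balance x i‖ ^ 2 + 2 * inner ℝ (balance x i) (𝔼 j, x j - c) + ‖𝔼 j, x j - c‖ ^ 2 :=
    fun i => by rw [← norm_add_sq_real, balance_apply, sub_add_sub_cancel]
  simp only [split, Finset.expect_add_distrib, ← Finset.mul_expect, ← inner_expect_left,
    Fintype.expect_balance, inner_zero_left, mul_zero, add_zero, Fintype.expect_const, dispersion]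

theorem dispersion_le_expect_norm_sub_sq [Nonempty ι] (x : ι → E) (c : E) :
    dispersion x ≤ 𝔼 i, ‖x i - c‖ ^ 2 := by
  rw [expect_norm_sub_sq]
  exact le_add_of_nonneg_right (sq_nonneg _)

theorem norm_expect_sq_le [Nonempty ι] (x : ι → E) : ‖𝔼 i, x i‖ ^ 2 ≤ 𝔼 i, ‖x i‖ ^ 2 := by
  have h := expect_norm_sub_sq x 0
  simp only [sub_zero] at h
  rw [h]
  exact le_add_of_nonneg_left (dispersion_nonneg x)

theorem balance_sub_smul (x y : ι → E) (c : ℝ) (i : ι) :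
    balance (fun i => x i - c • y i) i = balance x i - c • balance y i := by
  simp only [balance_apply, Finset.expect_sub_distrib, ← Finset.smul_expect]
  module

theorem familyCovariance_balance_right (x y : ι → E) :
    familyCovariance x (balance y) = familyCovariance x y := by
  simp only [familyCovariance, balance_apply y, inner_sub_right, Finset.expect_sub_distrib,
    ← inner_expect_left, Fintype.expect_balance, inner_zero_left, sub_zero]

theorem dispersion_sub_smul (x y : ι → E) (c : ℝ) :
    dispersion (fun i => x i - c • y i)
      = dispersion x - 2 * c * familyCovariance x y + c ^ 2 * dispersion y := by
  have expand : ∀ i, ‖balance (fun i => x i - c • y i) i‖ ^ 2 = ‖balance x i‖ ^ 2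
      - 2 * c * inner ℝ (balance x i) (balance y i) + c ^ 2 * ‖balance y i‖ ^ 2 := fun i => by
    rw [balance_sub_smul, norm_sub_sq_real, real_inner_smul_right, norm_smul, mul_pow,
      Real.norm_eq_abs, sq_abs, mul_assoc]
  simp only [dispersion, expand, Finset.expect_add_distrib, Finset.expect_sub_distrib,
    ← Finset.mul_expect]
  rw [← familyCovariance_balance_right, familyCovariance]

theorem familyCovariance_sq_le (x y : ι → E) :
    familyCovariance x y ^ 2 ≤ dispersion x * 𝔼 i, ‖y i‖ ^ 2 := by
  refine le_trans ?_ (Finset.expect_mul_sq_le_sq_mul_sq _ (fun i => ‖balance x i‖) fun i => ‖y i‖)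
  refine sq_le_sq.2 ((Finset.abs_expect_le _ _).trans ?_)
  refine (Finset.expect_le_expect fun i _ => abs_real_inner_le_norm _ _).trans (le_abs_self _)

theorem dispersion_sub_smul_sq_le [Nonempty ι] (u v : ι → E) (c : ℝ) :
    dispersion (fun i => u i - c • v i) ^ 2 ≤ dispersion u ^ 2
      - 4 * c * dispersion u * familyCovariance u v
      + 10 * c ^ 2 * dispersion u * 𝔼 i, ‖v i‖ ^ 2 + 2 * c ^ 4 * 𝔼 i, ‖v i‖ ^ 4 := by
  have hcov := familyCovariance_sq_le u v
  have hdisp : dispersion v ≤ 𝔼 i, ‖v i‖ ^ 2 := by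
    simpa using dispersion_le_expect_norm_sub_sq v 0
  have hdisp_sq : dispersion v ^ 2 ≤ 𝔼 i, ‖v i‖ ^ 4 := by
    refine (pow_le_pow_left₀ (dispersion_nonneg v) hdisp 2).trans ?_
    simpa only [Real.norm_eq_abs, sq_abs, show 4 = 2 * 2 from rfl, pow_mul] using
      norm_expect_sq_le fun i => ‖v i‖ ^ 2
  have hu := dispersion_nonneg u
  rw [dispersion_sub_smul]
  set U := dispersion u
  set V := familyCovariance u v
  set D := dispersion v
  have split : (U - 2 * c * V + c ^ 2 * D) ^ 2
      ≤ U ^ 2 - 4 * c * U * V + 2 * c ^ 2 * U * D + 8 * c ^ 2 * V ^ 2 + 2 * c ^ 4 * D ^ 2 := by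
    linarith [sq_nonneg (c ^ 2 * D + 2 * c * V)]
  have hV : 8 * c ^ 2 * V ^ 2 ≤ 8 * c ^ 2 * (U * 𝔼 i, ‖v i‖ ^ 2) := by gcongr
  have hD : 2 * c ^ 2 * U * D ≤ 2 * c ^ 2 * U * 𝔼 i, ‖v i‖ ^ 2 := by gcongr
  have hD_sq : 2 * c ^ 4 * D ^ 2 ≤ 2 * c ^ 4 * 𝔼 i, ‖v i‖ ^ 4 := by gcongr
  linarith

theorem FirstOrderConvex.expect {f : ι → E → ℝ} {g : ι → E → E}
    (h : ∀ i, FirstOrderConvex (f i) (g i)) :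
    FirstOrderConvex (fun x => 𝔼 i, f i x) fun x => 𝔼 i, g i x := fun x y => by
  rw [inner_expect_left, ← Finset.expect_add_distrib]
  exact Finset.expect_le_expect fun i _ => h i x y

theorem FirstOrderSmooth.expect [Nonempty ι] {H : ℝ} {f : ι → E → ℝ} {g : ι → E → E}
    (h : ∀ i, FirstOrderSmooth H (f i) (g i)) :
    FirstOrderSmooth H (fun x => 𝔼 i, f i x) fun x => 𝔼 i, g i x := fun x y => by
  rw [inner_expect_left, ← Finset.expect_add_distrib,
    ← Fintype.expect_const (ι := ι) (H / 2 * ‖x - y‖ ^ 2), ← Finset.expect_add_distrib]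
  exact Finset.expect_le_expect fun i _ => h i x y

end Dispersion

section DistributedGradients

open Fintype (balance balance_apply)

theorem norm_image_sub_sub_fderiv_le {E F : Type*} [NormedAddCommGroup E] [NormedSpace ℝ E]
    [NormedAddCommGroup F] [NormedSpace ℝ F] {g : E → F} {Q : ℝ} (hg : Differentiable ℝ g)
    (hlip : ∀ x y, ‖fderiv ℝ g x - fderiv ℝ g y‖ ≤ Q * ‖x - y‖) (x y : E) :
    ‖g y - g x - fderiv ℝ g x (y - x)‖ ≤ Q * ‖y - x‖ ^ 2 := by
  rcases eq_or_ne y x with rfl | hyx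
  · simp
  have hQ : 0 ≤ Q :=
    nonneg_of_mul_nonneg_left ((norm_nonneg _).trans (hlip y x))
      (norm_pos_iff.2 (sub_ne_zero.2 hyx))
  rw [pow_two, ← mul_assoc]
  refine (convex_segment (𝕜 := ℝ) x y).norm_image_sub_le_of_norm_fderiv_le' (𝕜 := ℝ)
    (fun z _ => hg z) (fun z hz => (hlip z x).trans ?_) (left_mem_segment ℝ x y)
    (right_mem_segment ℝ x y)
  gcongr
  obtain ⟨t, ht, rfl⟩ := segment_eq_image' ℝ x y ▸ hz
  simp only [add_sub_cancel_left, norm_smul, Real.norm_of_nonneg ht.1]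
  exact mul_le_of_le_one_left (norm_nonneg _) ht.2

variable {ι E : Type*} [Fintype ι] [NormedAddCommGroup E] [InnerProductSpace ℝ E] [Module ℚ≥0 E]

/-- The error made by a family of vector fields `g i`, evaluated at the points `x i` and averaged,
as an approximation of their average at the mean of the points. -/
noncomputable def gradientBias (g : ι → E → E) (x : ι → E) : E :=
  𝔼 i, (g i (x i) - g i (𝔼 j, x j))

/-- The family obtained from `x` by a gradient step of size `η` in each coordinate, for objectives
with gradients `g i` and an `ℓ²`-regularization of strength `μ`. -/
noncomputable def regularizedStep (η μ : ℝ) (g : ι → E → E) (x : ι → E) (i : ι) : E :=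
  x i - η • (g i (x i) + μ • x i)

theorem expect_regularizedStep (η μ : ℝ) (g : ι → E → E) (x : ι → E) :
    𝔼 i, regularizedStep η μ g x i = 𝔼 i, x i
      - η • (𝔼 i, g i (𝔼 j, x j) + μ • 𝔼 i, x i + gradientBias g x) := by
  simp only [regularizedStep, gradientBias, Finset.expect_sub_distrib, Finset.expect_add_distrib,
    ← Finset.smul_expect]
  module

/-- Since the deviations of the `x i` from their mean add up to zero, only the differences of the
`A i` matter. -/
theorem norm_expect_apply_balance_sq_le [Nonempty ι] {A : ι → E →L[ℝ] E} {τ : ℝ}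
    (hA : ∀ i j, ‖A i - A j‖ ≤ τ) (x : ι → E) :
    ‖𝔼 i, A i (balance x i)‖ ^ 2 ≤ τ ^ 2 * dispersion x := by
  let i₀ : ι := Classical.arbitrary ι
  have cancel : 𝔼 i, A i₀ (balance x i) = 0 :=
    (map_expect ((A i₀ : E →ₗ[ℝ] E).restrictScalars ℚ≥0) (balance x) _).symm.trans (by simp)
  have center : 𝔼 i, A i (balance x i) = 𝔼 i, (A i - A i₀) (balance x i) := by
    simp only [sub_apply, Finset.expect_sub_distrib, cancel, sub_zero]
  rw [center, dispersion, Finset.mul_expect]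
  refine (norm_expect_sq_le _).trans (Finset.expect_le_expect fun i _ => ?_)
  rw [← mul_pow]
  exact pow_le_pow_left₀ (norm_nonneg _) ((A i - A i₀).le_of_opNorm_le (hA i i₀) _) 2

theorem norm_gradientBias_sq_le [Nonempty ι] {g : ι → E → E} {Q τ : ℝ}
    (hdiff : ∀ i, Differentiable ℝ (g i))
    (hlip : ∀ i x y, ‖fderiv ℝ (g i) x - fderiv ℝ (g i) y‖ ≤ Q * ‖x - y‖)
    (hhet : ∀ i j x, ‖fderiv ℝ (g i) x - fderiv ℝ (g j) x‖ ≤ τ) (x : ι → E) :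
    ‖gradientBias g x‖ ^ 2 ≤ 2 * τ ^ 2 * dispersion x + 2 * Q ^ 2 * dispersion x ^ 2 := by
  set w := 𝔼 j, x j
  set linear := 𝔼 i, fderiv ℝ (g i) w (balance x i)
  set remainder := 𝔼 i, (g i (x i) - g i w - fderiv ℝ (g i) w (balance x i))
  have split : gradientBias g x = linear + remainder := by
    simp only [gradientBias, linear, remainder, Finset.expect_sub_distrib]
    abel
  have hlinear : ‖linear‖ ^ 2 ≤ τ ^ 2 * dispersion x :=
    norm_expect_apply_balance_sq_le (fun i j => hhet i j w) x
  have hremainder : ‖remainder‖ ≤ Q * dispersion x := by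
    rw [dispersion, Finset.mul_expect]
    exact (norm_expect_le _).trans (Finset.expect_le_expect fun i _ =>
      norm_image_sub_sub_fderiv_le (hdiff i) (hlip i) w (x i))
  have hremainder_sq := pow_le_pow_left₀ (norm_nonneg _) hremainder 2
  rw [split]
  linarith [norm_add_sq_le_two_mul linear remainder]

theorem dispersion_regularizedStep_le [Nonempty ι] {f : ι → E → ℝ} {g : ι → E → E}
    {H G η μ κ : ℝ} (hconv : ∀ i, FirstOrderConvex (f i) (g i))
    (hsmooth : ∀ i, FirstOrderSmooth H (f i) (g i)) (hhet : ∀ i j x, ‖g i x - g j x‖ ≤ G)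
    (hH : 0 < H) (hη : 0 ≤ η) (hμ : 0 ≤ μ) (hημ : η * μ ≤ 1 / 2) (hηH : η * H ≤ 1) (hκ : 0 < κ)
    (x : ι → E) :
    dispersion (regularizedStep η μ g x) ≤ (1 + 1 / κ) * dispersion x + (1 + κ) * (η * G) ^ 2 := by
  set w := 𝔼 j, x j
  let i₀ : ι := Classical.arbitrary ι
  set center := (1 - η * μ) • w - η • g i₀ w
  have hdev : ∀ i, ‖regularizedStep η μ g x i - center‖ ≤ ‖balance x i‖ + η * G := fun i => by
    have split : regularizedStep η μ g x i - center
        = (((1 - η * μ) • x i - η • g i (x i)) - ((1 - η * μ) • w - η • g i w))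
          - η • (g i w - g i₀ w) := by
      simp only [regularizedStep, center]
      module
    have hcontract := (hconv i).norm_damped_step_sub_le (hsmooth i) hH hη (a := 1 - η * μ)
      (by linarith) (by linarith [mul_nonneg hη hμ]) (by linarith) (x i) w
    have hgap : ‖η • (g i w - g i₀ w)‖ ≤ η * G := by
      rw [norm_smul, Real.norm_of_nonneg hη]
      gcongr
      exact hhet i i₀ w
    rw [split]
    exact (norm_sub_le _ _).trans (add_le_add hcontract hgap)
  calc dispersion (regularizedStep η μ g x)
      ≤ 𝔼 i, ‖regularizedStep η μ g x i - center‖ ^ 2 := dispersion_le_expect_norm_sub_sq _ _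
    _ ≤ 𝔼 i, ((1 + 1 / κ) * ‖balance x i‖ ^ 2 + (1 + κ) * (η * G) ^ 2) :=
      Finset.expect_le_expect fun i _ =>
        (pow_le_pow_left₀ (norm_nonneg _) (hdev i) 2).trans (add_sq_le_young _ _ hκ)
    _ = _ := by
      rw [Finset.expect_add_distrib, ← Finset.mul_expect, Fintype.expect_const, dispersion]

end DistributedGradients

section IntegralBounds

variable {Ω : Type*} [MeasurableSpace Ω] {ν : Measure Ω} {f g : Ω → ℝ} {a b c : ℝ}

/-- The function `f` is integrable and its integral is at most `b`. Integrability is part of the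
notion because the integral of a non-integrable function is `0` by convention. -/
structure HasIntegralLE (f : Ω → ℝ) (b : ℝ) (ν : Measure Ω) : Prop where
  integrable : Integrable f ν
  integral_le : ∫ ω, f ω ∂ν ≤ b

namespace HasIntegralLE

theorem mono (hf : HasIntegralLE f a ν) (hab : a ≤ b) : HasIntegralLE f b ν :=
  ⟨hf.integrable, hf.integral_le.trans hab⟩

theorem const [IsProbabilityMeasure ν] (a : ℝ) : HasIntegralLE (fun _ => a) a ν :=
  ⟨integrable_const a, by simp⟩

theorem add (hf : HasIntegralLE f a ν) (hg : HasIntegralLE g b ν) :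
    HasIntegralLE (fun ω => f ω + g ω) (a + b) ν :=
  ⟨hf.integrable.add hg.integrable, (integral_add hf.integrable hg.integrable).trans_le
    (add_le_add hf.integral_le hg.integral_le)⟩

theorem const_mul (hf : HasIntegralLE f a ν) (hc : 0 ≤ c) :
    HasIntegralLE (fun ω => c * f ω) (c * a) ν :=
  ⟨hf.integrable.const_mul c, (integral_const_mul c f).trans_le
    (mul_le_mul_of_nonneg_left hf.integral_le hc)⟩

theorem sub_const_mul (hf : HasIntegralLE f a ν) (hg : Integrable g ν) (c : ℝ) :
    HasIntegralLE (fun ω => f ω - c * g ω) (a - c * ∫ ω, g ω ∂ν) ν :=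
  ⟨hf.integrable.sub (hg.const_mul c), by
    rw [integral_sub hf.integrable (hg.const_mul c), integral_const_mul]
    exact sub_le_sub_right hf.integral_le _⟩

theorem of_nonneg_of_le (hg : HasIntegralLE g b ν) (hf : AEStronglyMeasurable f ν)
    (hf_nonneg : ∀ ω, 0 ≤ f ω) (hfg : ∀ ω, f ω ≤ g ω) : HasIntegralLE f b ν := by
  have hf_int : Integrable f ν := hg.integrable.mono' hf (.of_forall fun ω => by
    rw [Real.norm_of_nonneg (hf_nonneg ω)]
    exact hfg ω)
  exact ⟨hf_int, (integral_mono hf_int hg.integrable hfg).trans hg.integral_le⟩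

theorem finsetSum {ι : Type*} {s : Finset ι} {f : ι → Ω → ℝ} {b : ι → ℝ}
    (hf : ∀ i ∈ s, HasIntegralLE (f i) (b i) ν) :
    HasIntegralLE (fun ω => ∑ i ∈ s, f i ω) (∑ i ∈ s, b i) ν :=
  ⟨integrable_finsetSum _ fun i hi => (hf i hi).integrable, by
    rw [integral_finsetSum _ fun i hi => (hf i hi).integrable]
    exact Finset.sum_le_sum fun i hi => (hf i hi).integral_le⟩

theorem expect {ι : Type*} [Fintype ι] {f : ι → Ω → ℝ} {b : ι → ℝ}
    (hf : ∀ i, HasIntegralLE (f i) (b i) ν) :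
    HasIntegralLE (fun ω => 𝔼 i, f i ω) (𝔼 i, b i) ν := by
  simp only [expect_eq_one_div_card_smul_sum, smul_eq_mul]
  exact (finsetSum fun i _ => hf i).const_mul (by positivity)

/-- For `Y` independent of `X`, a bound on the expectation of `φ` with its first argument frozen
is a bound on the conditional expectation given `X`. -/
theorem comp_of_indepFun {S T : Type*} [MeasurableSpace S] [MeasurableSpace T]
    [IsProbabilityMeasure ν] {X : Ω → S} {Y : Ω → T} {φ : S × T → ℝ} {ψ : S → ℝ}
    (hX : Measurable X) (hY : Measurable Y) (hindep : IndepFun X Y ν) (hφ : Measurable φ)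
    (hφ_nonneg : ∀ p, 0 ≤ φ p) (hψ : Measurable ψ)
    (hfreeze : ∀ x, HasIntegralLE (fun y => φ (x, y)) (ψ x) (ν.map Y))
    (hb : HasIntegralLE (fun ω => ψ (X ω)) b ν) :
    HasIntegralLE (fun ω => φ (X ω, Y ω)) b ν := by
  have := Measure.isProbabilityMeasure_map hX.aemeasurable (μ := ν)
  have := Measure.isProbabilityMeasure_map hY.aemeasurable (μ := ν)
  have hprod := (indepFun_iff_map_prod_eq_prod_map_map hX.aemeasurable hY.aemeasurable).1 hindep
  have hψ_int : Integrable ψ (ν.map X) :=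
    (integrable_map_measure hψ.aestronglyMeasurable hX.aemeasurable).2 hb.integrable
  have hφ_int : Integrable φ ((ν.map X).prod (ν.map Y)) := by
    refine (integrable_prod_iff hφ.aestronglyMeasurable).2
      ⟨.of_forall fun x => (hfreeze x).integrable, hψ_int.mono'
        hφ.norm.stronglyMeasurable.integral_prod_right'.aestronglyMeasurable
        (.of_forall fun x => ?_)⟩
    simp only [Real.norm_of_nonneg (hφ_nonneg _)]
    rw [Real.norm_of_nonneg (integral_nonneg fun y => hφ_nonneg _)]
    exact (hfreeze x).integral_le
  refine ⟨(integrable_map_measure hφ.aestronglyMeasurable (hX.prodMk hY).aemeasurable).1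
    (hprod ▸ hφ_int), ?_⟩
  calc ∫ ω, φ (X ω, Y ω) ∂ν
      = ∫ x, ∫ y, φ (x, y) ∂(ν.map Y) ∂(ν.map X) := by
        rw [← integral_map (hX.prodMk hY).aemeasurable hφ.aestronglyMeasurable, hprod,
          integral_prod _ hφ_int]
    _ ≤ ∫ x, ψ x ∂(ν.map X) :=
        integral_mono hφ_int.integral_prod_left hψ_int fun x => (hfreeze x).integral_le
    _ = ∫ ω, ψ (X ω) ∂ν := integral_map hX.aemeasurable hψ.aestronglyMeasurable
    _ ≤ b := hb.integral_le

end HasIntegralLE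

end IntegralBounds

section CenteredNoise

variable {ι E Ω : Type*} [Fintype ι] [NormedAddCommGroup E] [InnerProductSpace ℝ E]
  [MeasurableSpace Ω] {ν : Measure Ω} {ξ : ι → Ω → E}

theorem integrable_expect_inner (hξ : ∀ i, Integrable (ξ i) ν) (v : ι → E) :
    Integrable (fun ω => 𝔼 i, inner ℝ (v i) (ξ i ω)) ν := by
  simp only [expect_eq_one_div_card_smul_sum, smul_eq_mul]
  exact (integrable_finsetSum _ fun i _ => (hξ i).const_inner (v i)).const_mul _

theorem integral_expect_inner_eq_zero [CompleteSpace E] (hξ : ∀ i, Integrable (ξ i) ν)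
    (hmean : ∀ i, ∫ ω, ξ i ω ∂ν = 0) (v : ι → E) :
    ∫ ω, 𝔼 i, inner ℝ (v i) (ξ i ω) ∂ν = 0 := by
  simp only [expect_eq_one_div_card_smul_sum, smul_eq_mul]
  rw [integral_const_mul, integral_finsetSum _ fun i _ => (hξ i).const_inner (v i)]
  simp only [integral_inner (hξ _), hmean, inner_zero_right, Finset.sum_const_zero, mul_zero]

theorem hasIntegralLE_sub_const_mul_expect_inner [CompleteSpace E] [IsProbabilityMeasure ν]
    (hξ : ∀ i, Integrable (ξ i) ν) (hmean : ∀ i, ∫ ω, ξ i ω ∂ν = 0) (a c : ℝ) (v : ι → E) :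
    HasIntegralLE (fun ω => a - c * 𝔼 i, inner ℝ (v i) (ξ i ω)) a ν := by
  simpa only [integral_expect_inner_eq_zero hξ hmean, mul_zero, sub_zero] using
    (HasIntegralLE.const a).sub_const_mul (integrable_expect_inner hξ v) c

variable [Module ℚ≥0 E]

theorem aestronglyMeasurable_expect (hξ : ∀ i, AEStronglyMeasurable (ξ i) ν) :
    AEStronglyMeasurable (fun ω => 𝔼 i, ξ i ω) ν := by
  simp only [expect_eq_one_div_card_smul_sum]
  exact (Finset.univ.aestronglyMeasurable_fun_sum fun i _ => hξ i).const_smul _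

theorem aestronglyMeasurable_dispersion (hξ : ∀ i, AEStronglyMeasurable (ξ i) ν) :
    AEStronglyMeasurable (fun ω => dispersion fun i => ξ i ω) ν := by
  simp only [dispersion, Fintype.balance_apply]
  exact aestronglyMeasurable_expect fun i =>
    ((hξ i).sub (aestronglyMeasurable_expect hξ)).norm.pow 2

variable [CompleteSpace E]

theorem hasIntegralLE_norm_expect_sq [MeasurableSpace E] [BorelSpace E] {b : ι → ℝ}
    (hξ : ∀ i, Integrable (ξ i) ν) (hmean : ∀ i, ∫ ω, ξ i ω ∂ν = 0)
    (hindep : Pairwise fun i j => IndepFun (ξ i) (ξ j) ν)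
    (hb : ∀ i, HasIntegralLE (fun ω => ‖ξ i ω‖ ^ 2) (b i) ν) :
    HasIntegralLE (fun ω => ‖𝔼 i, ξ i ω‖ ^ 2) ((𝔼 i, b i) / Fintype.card ι) ν := by
  classical
  have hpair : ∀ i j, HasIntegralLE (fun ω => inner ℝ (ξ j ω) (ξ i ω))
      (if i = j then b i else 0) ν := fun i j => by
    rcases eq_or_ne i j with rfl | hij
    · simpa only [real_inner_self_eq_norm_sq, if_true] using hb i
    · have hzero := (hindep hij.symm).integral_bilin (hξ j) (hξ i) (innerSL ℝ)
      rw [hmean, map_zero, zero_apply] at hzero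
      rw [if_neg hij]
      exact ⟨(hindep hij.symm).integrable_bilin (hξ j) (hξ i) (innerSL ℝ), hzero.le⟩
  simp only [← real_inner_self_eq_norm_sq, inner_expect_left, inner_expect_right]
  refine (HasIntegralLE.expect fun i => HasIntegralLE.expect (hpair i)).mono (le_of_eq ?_)
  simp only [expect_eq_one_div_card_smul_sum, Finset.sum_ite_eq, Finset.mem_univ, if_true,
    smul_eq_mul, ← Finset.mul_sum]
  ring

theorem hasIntegralLE_dispersion_sub_smul [Nonempty ι] [IsProbabilityMeasure ν] {b : ℝ}
    (hξ : ∀ i, Integrable (ξ i) ν) (hmean : ∀ i, ∫ ω, ξ i ω ∂ν = 0)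
    (hb : HasIntegralLE (fun ω => 𝔼 i, ‖ξ i ω‖ ^ 2) b ν) (u : ι → E) (c : ℝ) :
    HasIntegralLE (fun ω => dispersion fun i => u i - c • ξ i ω) (dispersion u + c ^ 2 * b) ν := by
  refine ((hasIntegralLE_sub_const_mul_expect_inner hξ hmean (dispersion u) (2 * c)
    (Fintype.balance u)).add (hb.const_mul (sq_nonneg c))).of_nonneg_of_le
    (aestronglyMeasurable_dispersion fun i =>
      aestronglyMeasurable_const.sub ((hξ i).1.const_smul c))
    (fun _ => dispersion_nonneg _) fun ω => ?_
  rw [dispersion_sub_smul, familyCovariance]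
  gcongr
  simpa using dispersion_le_expect_norm_sub_sq (fun i => ξ i ω) 0

theorem hasIntegralLE_dispersion_sub_smul_sq [Nonempty ι] [IsProbabilityMeasure ν] {b₂ b₄ : ℝ}
    (hξ : ∀ i, Integrable (ξ i) ν) (hmean : ∀ i, ∫ ω, ξ i ω ∂ν = 0)
    (hb₂ : HasIntegralLE (fun ω => 𝔼 i, ‖ξ i ω‖ ^ 2) b₂ ν)
    (hb₄ : HasIntegralLE (fun ω => 𝔼 i, ‖ξ i ω‖ ^ 4) b₄ ν) (u : ι → E) (c : ℝ) :
    HasIntegralLE (fun ω => dispersion (fun i => u i - c • ξ i ω) ^ 2)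
      ((dispersion u + 5 * c ^ 2 * b₂) ^ 2 + 2 * c ^ 4 * b₄) ν := by
  have hu := dispersion_nonneg u
  have hbound := ((hasIntegralLE_sub_const_mul_expect_inner hξ hmean (dispersion u ^ 2)
    (4 * c * dispersion u) (Fintype.balance u)).add
    (hb₂.const_mul (c := 10 * c ^ 2 * dispersion u) (by positivity))).add
    (hb₄.const_mul (c := 2 * c ^ 4) (by positivity))
  refine (hbound.of_nonneg_of_le ((aestronglyMeasurable_dispersion fun i =>
    aestronglyMeasurable_const.sub ((hξ i).1.const_smul c)).pow 2) (fun _ => sq_nonneg _)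
    fun ω => dispersion_sub_smul_sq_le u (fun i => ξ i ω) c).mono ?_
  linarith [sq_nonneg (5 * c ^ 2 * b₂)]

theorem hasIntegralLE_norm_expect_sub_smul_sub_sq [IsProbabilityMeasure ν] {b : ℝ}
    (hξ : ∀ i, Integrable (ξ i) ν) (hmean : ∀ i, ∫ ω, ξ i ω ∂ν = 0)
    (hb : HasIntegralLE (fun ω => ‖𝔼 i, ξ i ω‖ ^ 2) b ν) (u : ι → E) (c : ℝ) (y : E) :
    HasIntegralLE (fun ω => ‖𝔼 i, (u i - c • ξ i ω) - y‖ ^ 2)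
      (‖𝔼 i, u i - y‖ ^ 2 + c ^ 2 * b) ν := by
  have expand : ∀ ω, ‖𝔼 i, (u i - c • ξ i ω) - y‖ ^ 2 = ‖𝔼 i, u i - y‖ ^ 2
      - 2 * c * 𝔼 i, inner ℝ (𝔼 j, u j - y) (ξ i ω) + c ^ 2 * ‖𝔼 i, ξ i ω‖ ^ 2 := fun ω => by
    rw [← inner_expect_right, Finset.expect_sub_distrib, ← Finset.smul_expect, sub_right_comm,
      norm_sub_sq_real, real_inner_smul_right, norm_smul, mul_pow, Real.norm_eq_abs, sq_abs]
    ring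
  simp only [expand]
  exact (hasIntegralLE_sub_const_mul_expect_inner hξ hmean _ _ _).add (hb.const_mul (sq_nonneg c))

end CenteredNoise

section Recurrences

theorem one_add_inv_pow_le_three {K k : ℕ} (hk : k ≤ K) : (1 + 1 / (K : ℝ)) ^ k ≤ 3 :=
  calc (1 + 1 / (K : ℝ)) ^ k ≤ (1 + (K : ℝ)⁻¹) ^ K := by
        rw [one_div]
        exact pow_le_pow_right₀ (le_add_of_nonneg_right (by positivity)) hk
    _ ≤ Real.exp 1 := Real.one_add_inv_pow_le_exp
    _ ≤ 3 := Real.exp_one_lt_three.le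

theorem add_one_mod_eq_of_ne_zero {K t : ℕ} (h : (t + 1) % K ≠ 0) :
    (t + 1) % K = t % K + 1 := by
  rw [← Nat.mod_add_mod] at h ⊢
  rcases K.eq_zero_or_pos with rfl | hK
  · exact Nat.mod_zero _
  · refine Nat.mod_eq_of_lt (lt_of_le_of_ne (Nat.mod_lt t hK) fun hwrap => h ?_)
    exact (congrArg (· % K) hwrap).trans (Nat.mod_self K)

theorem sum_pow_mul_succ (r : ℝ) (f : ℕ → ℝ) (n : ℕ) :
    ∑ t ∈ Finset.range (n + 1), r ^ (n - t) * f t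
      = r * ∑ t ∈ Finset.range n, r ^ (n - 1 - t) * f t + f n := by
  rw [Finset.sum_range_succ, Finset.mul_sum, Nat.sub_self, pow_zero, one_mul]
  congr 1
  refine Finset.sum_congr rfl fun t ht => ?_
  rw [← mul_assoc, ← pow_succ', Nat.sub_right_comm, Nat.sub_add_cancel]
  have := Finset.mem_range.1 ht
  omega

theorem sum_pow_mul_le_of_contraction {D δ : ℕ → ℝ} {r η c : ℝ} (hr : 0 ≤ r)
    (hstep : ∀ t, D (t + 1) ≤ r * D t - η * δ t + c) (n : ℕ) :
    η * ∑ t ∈ Finset.range n, r ^ (n - 1 - t) * δ t + D n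
      ≤ r ^ n * D 0 + c * ∑ t ∈ Finset.range n, r ^ (n - 1 - t) := by
  induction n with
  | zero => simp
  | succ n ih =>
    have weights := sum_pow_mul_succ r (fun _ => 1) n
    simp only [mul_one] at weights
    rw [Nat.add_sub_cancel, sum_pow_mul_succ, weights, pow_succ']
    linarith [hstep n, mul_le_mul_of_nonneg_left ih hr]

theorem centerMass_pow_le_of_contraction {D δ : ℕ → ℝ} {r η c : ℝ} (hr : 0 < r) (hr_le : r ≤ 1)
    (hη : 0 < η) (hD : ∀ t, 0 ≤ D t) (hstep : ∀ t, D (t + 1) ≤ r * D t - η * δ t + c) {n : ℕ}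
    (hn : 0 < n) :
    (Finset.range n).centerMass (fun t => r ^ (n - 1 - t)) δ ≤ D 0 / (η * n) + c / η := by
  have hn_pos : (0 : ℝ) < n := Nat.cast_pos.2 hn
  have hunroll := sum_pow_mul_le_of_contraction hr.le hstep n
  simp only [Finset.centerMass, smul_eq_mul]
  set W := ∑ t ∈ Finset.range n, r ^ (n - 1 - t)
  have hpow_le : n * r ^ n ≤ W := by
    simpa using (Finset.range n).card_nsmul_le_sum (fun t => r ^ (n - 1 - t)) (r ^ n)
      fun t _ => pow_le_pow_of_le_one hr.le hr_le (by omega)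
  have hW : 0 < W := lt_of_lt_of_le (by positivity) hpow_le
  have hinit : r ^ n * D 0 ≤ W / n * D 0 := by
    gcongr
    · exact hD 0
    · rwa [le_div_iff₀' hn_pos]
  rw [inv_mul_le_iff₀ hW, ← mul_le_mul_iff_right₀ hη]
  calc η * ∑ t ∈ Finset.range n, r ^ (n - 1 - t) * δ t
      ≤ W / n * D 0 + c * W := by linarith [hD n]
    _ = η * (W * (D 0 / (η * n) + c / η)) := by field_simp

end Recurrences

theorem HasIntegralLE.comp_eval {ι : Type*} [Fintype ι] {X : ι → Type*}
    [∀ i, MeasurableSpace (X i)] {μ : ∀ i, Measure (X i)} [∀ i, IsProbabilityMeasure (μ i)]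
    {i : ι} {f : X i → ℝ} {b : ℝ} (hf : HasIntegralLE f b (μ i)) :
    HasIntegralLE (fun x => f (x i)) b (Measure.pi μ) :=
  ⟨integrable_comp_eval hf.integrable,
    (integral_comp_eval hf.integrable.aestronglyMeasurable).trans_le hf.integral_le⟩

namespace FedProblem

variable {d M : ℕ} {Z : Type*} [MeasurableSpace Z] {P : FedProblem d M Z}

instance isProbabilityMeasure_dist (m : Fin M) : IsProbabilityMeasure (P.dist m) := P.isProb m

theorem expect_eq_one_div_mul_sum (a : Fin M → ℝ) : 𝔼 m, a m = 1 / (M : ℝ) * ∑ m, a m := by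
  rw [expect_eq_one_div_card_smul_sum, Fintype.card_fin, smul_eq_mul]

theorem avg_eq_expect : P.avg = fun x => 𝔼 m, P.F m x := by
  funext x
  rw [avg, expect_eq_one_div_mul_sum]

theorem continuous_avg : Continuous P.avg :=
  continuous_const.mul (continuous_finsetSum _ fun m _ => (P.differentiable m).continuous)

theorem Convex.avg (h : P.Convex) : FirstOrderConvex P.avg fun x => 𝔼 m, ∇ (P.F m) x :=
  avg_eq_expect (P := P) ▸ FirstOrderConvex.expect h

theorem SecondOrderSmooth.avg [NeZero M] {H : ℝ} (h : P.SecondOrderSmooth H) :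
    FirstOrderSmooth H P.avg fun x => 𝔼 m, ∇ (P.F m) x :=
  avg_eq_expect (P := P) ▸ FirstOrderSmooth.expect h

theorem ThirdOrderSmooth.differentiable_gradient {Q : ℝ} (h : P.ThirdOrderSmooth Q) (m : Fin M) :
    Differentiable ℝ (∇ (P.F m)) :=
  (InnerProductSpace.toDual ℝ (Vec d)).symm.differentiable.comp
    (((h m).1.fderiv_right (m := 1) (by norm_num)).differentiable (by norm_num))

/-- The gradient noise of the oracle of machine `m`, as a function of the sample. -/
noncomputable def noise (P : FedProblem d M Z) (m : Fin M) (x : Vec d) (z : Z) : Vec d :=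
  P.grad m x z - ∇ (P.F m) x

theorem measurable_noise (m : Fin M) (x : Vec d) : Measurable (P.noise m x) :=
  ((P.measurable_grad m).comp measurable_prodMk_left).sub_const _

theorem integrable_noise (m : Fin M) (x : Vec d) : Integrable (P.noise m x) (P.dist m) :=
  (P.integrable_grad m x).sub (integrable_const _)

theorem integral_noise (m : Fin M) (x : Vec d) : ∫ z, P.noise m x z ∂(P.dist m) = 0 := by
  simp only [noise]
  rw [integral_sub (P.integrable_grad m x) (integrable_const _), P.integral_grad]
  simp

theorem integrable_noise_eval (m : Fin M) (x : Vec d) :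
    Integrable (fun z : Fin M → Z => P.noise m x (z m)) (Measure.pi P.dist) :=
  integrable_comp_eval (integrable_noise m x)

theorem integral_noise_eval (m : Fin M) (x : Vec d) :
    ∫ z, P.noise m x (z m) ∂(Measure.pi P.dist) = 0 :=
  (integral_comp_eval (integrable_noise m x).aestronglyMeasurable).trans (integral_noise m x)

theorem indepFun_noise_eval (x : Fin M → Vec d) :
    Pairwise fun m n => IndepFun (fun z : Fin M → Z => P.noise m (x m) (z m))
      (fun z => P.noise n (x n) (z n)) (Measure.pi P.dist) := fun _ _ hmn =>
  (iIndepFun_pi fun k => (measurable_noise k (x k)).aemeasurable).indepFun hmn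

theorem hasIntegralLE_norm_noise_pow_eval {k : ℕ} {b : ℝ} {m : Fin M} {x : Vec d}
    (hb : Integrable (fun z => ‖P.noise m x z‖ ^ k) (P.dist m) ∧
      ∫ z, ‖P.noise m x z‖ ^ k ∂(P.dist m) ≤ b) :
    HasIntegralLE (fun z : Fin M → Z => ‖P.noise m x (z m)‖ ^ k) b (Measure.pi P.dist) :=
  HasIntegralLE.comp_eval (X := fun _ => Z) (μ := P.dist) (i := m) ⟨hb.1, hb.2⟩

theorem BoundedSecondMoment.hasIntegralLE_expect {σ₂ : ℝ} (h : P.BoundedSecondMoment σ₂)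
    (x : Fin M → Vec d) :
    HasIntegralLE (fun z => 𝔼 m, ‖P.noise m (x m) (z m)‖ ^ 2) (σ₂ ^ 2) (Measure.pi P.dist) := by
  obtain ⟨s, -, hmean, hmoment⟩ := h
  have hnoise : ∀ m, HasIntegralLE (fun z : Fin M → Z => ‖P.noise m (x m) (z m)‖ ^ 2) (s m ^ 2)
      (Measure.pi P.dist) := fun m => hasIntegralLE_norm_noise_pow_eval (hmoment m (x m))
  rw [← expect_eq_one_div_mul_sum] at hmean
  exact hmean ▸ HasIntegralLE.expect hnoise

theorem BoundedFourthMoment.hasIntegralLE_expect {σ₄ : ℝ} (h : P.BoundedFourthMoment σ₄)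
    (x : Fin M → Vec d) :
    HasIntegralLE (fun z => 𝔼 m, ‖P.noise m (x m) (z m)‖ ^ 4) (σ₄ ^ 4) (Measure.pi P.dist) := by
  obtain ⟨s, -, hmean, hmoment⟩ := h
  have hnoise : ∀ m, HasIntegralLE (fun z : Fin M → Z => ‖P.noise m (x m) (z m)‖ ^ 4) (s m ^ 4)
      (Measure.pi P.dist) := fun m => hasIntegralLE_norm_noise_pow_eval (hmoment m (x m))
  rw [← expect_eq_one_div_mul_sum] at hmean
  exact hmean ▸ HasIntegralLE.expect hnoise

theorem BoundedSecondMoment.hasIntegralLE_norm_expect {σ₂ : ℝ} (h : P.BoundedSecondMoment σ₂)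
    (x : Fin M → Vec d) :
    HasIntegralLE (fun z => ‖𝔼 m, P.noise m (x m) (z m)‖ ^ 2) (σ₂ ^ 2 / M) (Measure.pi P.dist) := by
  obtain ⟨s, -, hmean, hmoment⟩ := h
  have hnoise : ∀ m, HasIntegralLE (fun z : Fin M → Z => ‖P.noise m (x m) (z m)‖ ^ 2) (s m ^ 2)
      (Measure.pi P.dist) := fun m => hasIntegralLE_norm_noise_pow_eval (hmoment m (x m))
  have hbound := hasIntegralLE_norm_expect_sq (fun m => integrable_noise_eval m (x m))
    (fun m => integral_noise_eval m (x m)) (indepFun_noise_eval x) hnoise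
  rwa [expect_eq_one_div_mul_sum, hmean, Fintype.card_fin] at hbound

/-- One step of local SGD on the regularized problem from the points `x m`, with the samples `z m`
and before any communication. -/
noncomputable def localStep (P : FedProblem d M Z) (η μ : ℝ) (x : Fin M → Vec d) (z : Fin M → Z)
    (m : Fin M) : Vec d :=
  regularizedStep η μ (fun n => ∇ (P.F n)) x m - η • P.noise m (x m) (z m)

theorem localStep_apply (η μ : ℝ) (x : Fin M → Vec d) (z : Fin M → Z) (m : Fin M) :
    P.localStep η μ x z m = x m - η • (P.regularize μ).grad m (x m) (z m) := by
  simp only [localStep, regularizedStep, noise, regularize]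
  module

theorem measurable_localStep (η μ : ℝ) :
    Measurable fun p : (Fin M → Vec d) × (Fin M → Z) => P.localStep η μ p.1 p.2 := by
  refine measurable_pi_lambda _ fun m => ?_
  simp only [localStep_apply]
  have hx : Measurable fun p : (Fin M → Vec d) × (Fin M → Z) => p.1 m := by fun_prop
  have hz : Measurable fun p : (Fin M → Vec d) × (Fin M → Z) => p.2 m := by fun_prop
  exact hx.sub ((((P.regularize μ).measurable_grad m).comp (hx.prodMk hz)).const_smul η)

section StepBounds

variable [NeZero M] {H G Q τ σ₂ σ₄ η μ κ : ℝ}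

theorem hasIntegralLE_dispersion_localStep (hconv : P.Convex) (hsmooth : P.SecondOrderSmooth H)
    (hnoise : P.BoundedSecondMoment σ₂) (hhet : ∀ m n x, ‖∇ (P.F m) x - ∇ (P.F n) x‖ ≤ G)
    (hH : 0 < H) (hη : 0 ≤ η) (hμ : 0 ≤ μ) (hημ : η * μ ≤ 1 / 2) (hηH : η * H ≤ 1) (hκ : 0 < κ)
    (x : Fin M → Vec d) :
    HasIntegralLE (fun z => dispersion (P.localStep η μ x z))
      ((1 + 1 / κ) * dispersion x + ((1 + κ) * (η * G) ^ 2 + η ^ 2 * σ₂ ^ 2))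
      (Measure.pi P.dist) :=
  (hasIntegralLE_dispersion_sub_smul (fun m => integrable_noise_eval m (x m))
    (fun m => integral_noise_eval m (x m)) (hnoise.hasIntegralLE_expect x) _ η).mono <| by
      linarith [dispersion_regularizedStep_le hconv hsmooth hhet hH hη hμ hημ hηH hκ x]

theorem hasIntegralLE_dispersion_localStep_sq (hconv : P.Convex) (hsmooth : P.SecondOrderSmooth H)
    (hnoise₂ : P.BoundedSecondMoment σ₂) (hnoise₄ : P.BoundedFourthMoment σ₄)
    (hhet : ∀ m n x, ‖∇ (P.F m) x - ∇ (P.F n) x‖ ≤ G) (hH : 0 < H) (hη : 0 ≤ η) (hμ : 0 ≤ μ)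
    (hημ : η * μ ≤ 1 / 2) (hηH : η * H ≤ 1) (hκ : 0 < κ) (x : Fin M → Vec d) :
    HasIntegralLE (fun z => dispersion (P.localStep η μ x z) ^ 2)
      ((1 + 1 / κ) ^ 3 * dispersion x ^ 2
        + ((1 + κ) * ((1 + κ) * (η * G) ^ 2 + 5 * η ^ 2 * σ₂ ^ 2) ^ 2 + 2 * η ^ 4 * σ₄ ^ 4))
      (Measure.pi P.dist) := by
  refine (hasIntegralLE_dispersion_sub_smul_sq (fun m => integrable_noise_eval m (x m))
    (fun m => integral_noise_eval m (x m)) (hnoise₂.hasIntegralLE_expect x)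
    (hnoise₄.hasIntegralLE_expect x) _ η).mono ?_
  set u := regularizedStep η μ (fun n => ∇ (P.F n)) x
  have hdrift : dispersion u ≤ (1 + 1 / κ) * dispersion x + (1 + κ) * (η * G) ^ 2 :=
    dispersion_regularizedStep_le hconv hsmooth hhet hH hη hμ hημ hηH hκ x
  have hu := dispersion_nonneg u
  have hsq : (dispersion u + 5 * η ^ 2 * σ₂ ^ 2) ^ 2
      ≤ ((1 + 1 / κ) * dispersion x + ((1 + κ) * (η * G) ^ 2 + 5 * η ^ 2 * σ₂ ^ 2)) ^ 2 :=
    pow_le_pow_left₀ (by positivity) (by linarith) 2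
  have hyoung := add_sq_le_young ((1 + 1 / κ) * dispersion x)
    ((1 + κ) * (η * G) ^ 2 + 5 * η ^ 2 * σ₂ ^ 2) hκ
  linarith

theorem hasIntegralLE_norm_expect_localStep_sub_sq (hconv : P.Convex)
    (hsmooth₂ : P.SecondOrderSmooth H) (hsmooth₃ : P.ThirdOrderSmooth Q)
    (hnoise : P.BoundedSecondMoment σ₂) (hhet : P.SecondOrderHeterogeneity τ) (hH : 0 < H)
    (hη : 0 < η) (hμ : 0 < μ) (hημ : η * μ ≤ 1 / 4) (hηH : 8 * (η * H) ≤ 1) {y : Vec d}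
    (hy : y ∈ P.optima) (x : Fin M → Vec d) :
    HasIntegralLE (fun z => ‖𝔼 m, P.localStep η μ x z m - y‖ ^ 2)
      ((1 - η * μ / 2) * ‖𝔼 m, x m - y‖ ^ 2 - η * (P.avg (𝔼 m, x m) - P.avg y)
        + (3 * η / μ * (2 * τ ^ 2 * dispersion x + 2 * Q ^ 2 * dispersion x ^ 2)
          + (η * μ * ‖y‖ ^ 2 + η ^ 2 * (σ₂ ^ 2 / M))))
      (Measure.pi P.dist) := by
  refine (hasIntegralLE_norm_expect_sub_smul_sub_sq (fun m => integrable_noise_eval m (x m))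
    (fun m => integral_noise_eval m (x m)) (hnoise.hasIntegralLE_norm_expect x) _ η y).mono ?_
  have hmean := norm_inexact_regularized_step_sub_sq_le hconv.avg hsmooth₂.avg hH hη hμ hημ hηH hy
    (𝔼 m, x m) (gradientBias (fun m => ∇ (P.F m)) x)
  have hbias := mul_le_mul_of_nonneg_left
    (norm_gradientBias_sq_le hsmooth₃.differentiable_gradient (fun m => (hsmooth₃ m).2) hhet x)
    (show 0 ≤ 3 * η / μ by positivity)
  rw [expect_regularizedStep]
  linarith

end StepBounds

end FedProblem

section LocalSGD

variable {d M : ℕ} {Z : Type*}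

theorem localSGD_congr (g : Fin M → Vec d → Z → Vec d) (η : ℝ) (K : ℕ) {z z' : ℕ → Fin M → Z}
    {t : ℕ} (h : ∀ s < t, z s = z' s) : localSGD g η K z t = localSGD g η K z' t := by
  induction t with
  | zero => rfl
  | succ t ih =>
    funext m
    simp only [localSGD, ih fun s hs => h s (hs.trans t.lt_succ_self), h t t.lt_succ_self]

theorem measurable_localSGD [MeasurableSpace Z] {g : Fin M → Vec d → Z → Vec d}
    (hg : ∀ m, Measurable fun p : Vec d × Z => g m p.1 p.2) (η : ℝ) (K t : ℕ) :
    Measurable fun z : ℕ → Fin M → Z => localSGD g η K z t := by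
  induction t with
  | zero => exact measurable_const
  | succ t ih =>
    have hstep : ∀ m, Measurable fun z : ℕ → Fin M → Z =>
        localSGD g η K z t m - η • g m (localSGD g η K z t m) (z t m) := fun m => by
      have hx : Measurable fun z : ℕ → Fin M → Z => localSGD g η K z t m :=
        (measurable_pi_apply m).comp ih
      have hz : Measurable fun z : ℕ → Fin M → Z => z t m := by fun_prop
      exact hx.sub (((hg m).comp (hx.prodMk hz)).const_smul η)
    refine measurable_pi_lambda _ fun m => ?_
    simp only [localSGD]
    split_ifs
    · exact (Finset.measurable_sum _ fun n _ => hstep n).const_smul (1 / (M : ℝ))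
    · exact hstep m

end LocalSGD

namespace FedProblem

variable {d M : ℕ} {Z Ω : Type*} [MeasurableSpace Z] {P : FedProblem d M Z}
  {z : ℕ → Fin M → Ω → Z}

/-- The iterates of local SGD on the problem `P` regularized with strength `μ`, as random
variables of the outcome `ω` behind the samples `z`. -/
noncomputable def regularizedIterate (P : FedProblem d M Z) (η μ : ℝ) (K : ℕ)
    (z : ℕ → Fin M → Ω → Z) (t : ℕ) (ω : Ω) : Fin M → Vec d :=
  localSGD (P.regularize μ).grad η K (fun s m => z s m ω) t

theorem regularizedIterate_succ (η μ : ℝ) (K t : ℕ) (ω : Ω) :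
    P.regularizedIterate η μ K z (t + 1) ω =
      if (t + 1) % K = 0 then
        fun _ => 𝔼 n, P.localStep η μ (P.regularizedIterate η μ K z t ω) (fun m => z t m ω) n
      else P.localStep η μ (P.regularizedIterate η μ K z t ω) (fun m => z t m ω) := by
  funext m
  split_ifs with h <;>
    simp only [regularizedIterate, localSGD, h, if_true, if_false, localStep_apply,
      expect_eq_one_div_card_smul_sum, Fintype.card_fin]

theorem expect_regularizedIterate_succ [NeZero M] (η μ : ℝ) (K t : ℕ) (ω : Ω) :
    𝔼 m, P.regularizedIterate η μ K z (t + 1) ω m =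
      𝔼 m, P.localStep η μ (P.regularizedIterate η μ K z t ω) (fun m => z t m ω) m := by
  rw [regularizedIterate_succ]
  split_ifs
  · exact Fintype.expect_const _
  · rfl

theorem weightedIterate_eq_centerMass (η μ : ℝ) (K R : ℕ) (ω : Ω) :
    (P.regularize μ).weightedIterate η μ K R (fun t m => z t m ω) =
      (Finset.range (K * R)).centerMass (fun t => (1 - η * μ / 2) ^ (K * R - 1 - t))
        fun t => 𝔼 m, P.regularizedIterate η μ K z t ω m := by
  simp only [weightedIterate, Finset.centerMass, avgIterate, regularizedIterate, one_div,
    expect_eq_one_div_card_smul_sum, Fintype.card_fin]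

namespace IsSampling

variable [MeasurableSpace Ω] {ν : Measure Ω}

theorem measurable_samples (hz : P.IsSampling ν z) (t : ℕ) : Measurable fun ω m => z t m ω :=
  measurable_pi_lambda _ fun m => hz.measurable t m

theorem measurable_regularizedIterate (hz : P.IsSampling ν z) (η μ : ℝ) (K t : ℕ) :
    Measurable (P.regularizedIterate η μ K z t) :=
  (measurable_localSGD (P.regularize μ).measurable_grad η K t).comp
    (measurable_pi_lambda _ hz.measurable_samples)

variable [IsProbabilityMeasure ν]

theorem map_eq_pi (hz : P.IsSampling ν z) (t : ℕ) :
    ν.map (fun ω m => z t m ω) = Measure.pi P.dist := by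
  have hindep : iIndepFun (fun m => z t m) ν :=
    hz.indep.precomp (g := fun m : Fin M => (t, m)) fun _ _ h => (Prod.ext_iff.1 h).2
  rw [(iIndepFun_iff_map_fun_eq_pi_map fun m => (hz.measurable t m).aemeasurable).1 hindep]
  simp only [hz.law]

theorem indepFun_regularizedIterate (hz : P.IsSampling ν z) (η μ : ℝ) (K t : ℕ) :
    IndepFun (P.regularizedIterate η μ K z t) (fun ω m => z t m ω) ν := by
  classical
  obtain ⟨ω₀⟩ : Nonempty Ω := nonempty_of_isProbabilityMeasure ν
  let past : Finset (ℕ × Fin M) := Finset.range t ×ˢ Finset.univ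
  let present : Finset (ℕ × Fin M) := {t} ×ˢ Finset.univ
  have hdisj : Disjoint past present := by
    refine Finset.disjoint_product.2 (.inl ?_)
    simp
  let extend : (past → Z) → ℕ → Fin M → Z := fun f s m =>
    if h : (s, m) ∈ past then f ⟨(s, m), h⟩ else z s m ω₀
  have hextend : Measurable extend := by
    refine measurable_pi_lambda _ fun s => measurable_pi_lambda _ fun m => ?_
    by_cases h : (s, m) ∈ past
    · simpa only [extend, h, dif_pos] using measurable_pi_apply _
    · simpa only [extend, h, dif_neg, not_false_iff] using measurable_const
  let row : (present → Z) → Fin M → Z := fun f m => f ⟨(t, m), by simp [present]⟩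
  have hrow : Measurable row := measurable_pi_lambda _ fun m => measurable_pi_apply _
  have hindep := (hz.indep.indepFun_finset past present hdisj fun p => hz.measurable p.1 p.2).comp
    ((measurable_localSGD (P.regularize μ).measurable_grad η K t).comp hextend) hrow
  refine hindep.congr (.of_forall fun ω => ?_) (.of_forall fun ω => rfl)
  refine localSGD_congr _ η K fun s hs => funext fun m => ?_
  have hmem : (s, m) ∈ past := by simpa [past] using hs
  simp only [extend, hmem, dif_pos]

theorem hasIntegralLE_localStep (hz : P.IsSampling ν z) {η μ b : ℝ} {K t : ℕ}
    {φ ψ : (Fin M → Vec d) → ℝ} (hφ : Measurable φ) (hφ_nonneg : ∀ x, 0 ≤ φ x)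
    (hψ : Measurable ψ)
    (hstep : ∀ x, HasIntegralLE (fun y => φ (P.localStep η μ x y)) (ψ x) (Measure.pi P.dist))
    (hb : HasIntegralLE (fun ω => ψ (P.regularizedIterate η μ K z t ω)) b ν) :
    HasIntegralLE (fun ω => φ (P.localStep η μ (P.regularizedIterate η μ K z t ω)
      fun m => z t m ω)) b ν :=
  HasIntegralLE.comp_of_indepFun (φ := fun p => φ (P.localStep η μ p.1 p.2))
    (hz.measurable_regularizedIterate η μ K t) (hz.measurable_samples t)
    (hz.indepFun_regularizedIterate η μ K t) (hφ.comp (measurable_localStep η μ))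
    (fun _ => hφ_nonneg _) hψ (by rwa [hz.map_eq_pi]) hb

/-- A quantity that vanishes on consensus is reset at every communication, so it can only grow
over the `t % K` local steps since the last one. -/
theorem hasIntegralLE_of_consensus_zero (hz : P.IsSampling ν z) {η μ r p : ℝ} {K : ℕ}
    {φ : (Fin M → Vec d) → ℝ} (hφ : Measurable φ) (hφ_nonneg : ∀ x, 0 ≤ φ x)
    (hφ_const : ∀ c, φ (fun _ => c) = 0) (hr : 1 ≤ r) (hp : 0 ≤ p)
    (hstep : ∀ x, HasIntegralLE (fun y => φ (P.localStep η μ x y)) (r * φ x + p)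
      (Measure.pi P.dist)) (t : ℕ) :
    HasIntegralLE (fun ω => φ (P.regularizedIterate η μ K z t ω))
      ((t % K : ℕ) * (r ^ (t % K) * p)) ν := by
  induction t with
  | zero =>
    have hzero : ∀ ω, φ (P.regularizedIterate η μ K z 0 ω) = 0 := fun _ => hφ_const 0
    simpa [hzero] using HasIntegralLE.const (ν := ν) 0
  | succ t ih =>
    simp only [regularizedIterate_succ]
    split_ifs with hsync
    · simpa [hsync, hφ_const] using HasIntegralLE.const (ν := ν) 0
    · refine (hz.hasIntegralLE_localStep hφ hφ_nonneg ((hφ.const_mul r).add_const p) hstep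
        ((ih.const_mul (zero_le_one.trans hr)).add (.const p))).mono ?_
      rw [add_one_mod_eq_of_ne_zero hsync, pow_succ']
      have hgrowth : p ≤ r * r ^ (t % K) * p :=
        le_mul_of_one_le_left hp (one_le_mul_of_one_le_of_one_le hr (one_le_pow₀ hr))
      push_cast
      linarith

theorem hasIntegralLE_of_consensus_zero_of_one_add_inv_pow (hz : P.IsSampling ν z) {η μ p : ℝ}
    {K j : ℕ} (hK : 0 < K) {φ : (Fin M → Vec d) → ℝ} (hφ : Measurable φ)
    (hφ_nonneg : ∀ x, 0 ≤ φ x) (hφ_const : ∀ c, φ (fun _ => c) = 0) (hp : 0 ≤ p)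
    (hstep : ∀ x, HasIntegralLE (fun y => φ (P.localStep η μ x y))
      ((1 + 1 / (K : ℝ)) ^ j * φ x + p) (Measure.pi P.dist)) (t : ℕ) :
    HasIntegralLE (fun ω => φ (P.regularizedIterate η μ K z t ω)) (K * (3 ^ j * p)) ν := by
  have hmod : t % K ≤ K := (Nat.mod_lt t hK).le
  have hr : 1 ≤ 1 + 1 / (K : ℝ) := le_add_of_nonneg_right (by positivity)
  refine (hz.hasIntegralLE_of_consensus_zero hφ hφ_nonneg hφ_const (one_le_pow₀ hr) hp hstep
    t).mono ?_
  rw [pow_right_comm]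
  gcongr
  exact one_add_inv_pow_le_three hmod

end IsSampling

end FedProblem

theorem HasIntegralLE.centerMass {ι Ω : Type*} [MeasurableSpace Ω] {ν : Measure Ω} {s : Finset ι}
    {w : ι → ℝ} {f : ι → Ω → ℝ} {b : ι → ℝ} (hw : ∀ i ∈ s, 0 ≤ w i)
    (hf : ∀ i ∈ s, HasIntegralLE (f i) (b i) ν) :
    HasIntegralLE (fun ω => s.centerMass w fun i => f i ω) (s.centerMass w b) ν :=
  (HasIntegralLE.finsetSum fun i hi => (hf i hi).const_mul (hw i hi)).const_mul
    (inv_nonneg.2 (Finset.sum_nonneg hw))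

/-- Bound on the expected dispersion of the iterates of local SGD with `K` local steps per round, in
units of `η²`, for gradients that differ by at most `G` between machines and noise of variance
`σ₂²`. -/
noncomputable def driftSecondMoment (K G σ₂ : ℝ) : ℝ :=
  3 * K * ((1 + K) * G ^ 2 + σ₂ ^ 2)

/-- Bound on the expected squared dispersion of the iterates of local SGD with `K` local steps per
round, in units of `η⁴`, for gradients that differ by at most `G` between machines and noise with
second moment `σ₂²` and fourth moment `σ₄⁴`. -/
noncomputable def driftFourthMoment (K G σ₂ σ₄ : ℝ) : ℝ :=
  27 * K * ((1 + K) * ((1 + K) * G ^ 2 + 5 * σ₂ ^ 2) ^ 2 + 2 * σ₄ ^ 4)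

namespace FedProblem.IsSampling

variable {d M : ℕ} {Z Ω : Type*} [MeasurableSpace Z] {P : FedProblem d M Z}
  {z : ℕ → Fin M → Ω → Z} [MeasurableSpace Ω] {ν : Measure Ω}
  {H G Q τ σ₂ σ₄ η μ v₂ v₄ : ℝ} {K R : ℕ}

theorem hasIntegralLE_avg_weightedIterate_sub (hz : P.IsSampling ν z) (hconv : P.Convex)
    (hημ : η * μ < 2) {y : Vec d} (hy : y ∈ P.optima) (hn : 0 < K * R)
    (hgap : ∀ t, Integrable
      (fun ω => P.avg (𝔼 m, P.regularizedIterate η μ K z t ω m) - P.avg y) ν) :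
    HasIntegralLE (fun ω => P.avg ((P.regularize μ).weightedIterate η μ K R fun t m => z t m ω)
        - P.avg y)
      ((Finset.range (K * R)).centerMass (fun t => (1 - η * μ / 2) ^ (K * R - 1 - t)) fun t =>
        ∫ ω, P.avg (𝔼 m, P.regularizedIterate η μ K z t ω m) - P.avg y ∂ν) ν := by
  have hr : 0 < 1 - η * μ / 2 := by linarith
  have hweight : ∀ t ∈ Finset.range (K * R), 0 ≤ (1 - η * μ / 2) ^ (K * R - 1 - t) :=
    fun t _ => by positivity
  have hmean : ∀ t, Measurable fun ω => 𝔼 m, P.regularizedIterate η μ K z t ω m := fun t =>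
    continuous_expect.measurable.comp (hz.measurable_regularizedIterate η μ K t)
  have hmeas : Measurable fun ω =>
      P.avg ((P.regularize μ).weightedIterate η μ K R fun t m => z t m ω) := by
    simp only [weightedIterate_eq_centerMass, Finset.centerMass]
    exact continuous_avg.measurable.comp (by fun_prop)
  refine (HasIntegralLE.centerMass hweight fun t _ => ⟨hgap t, le_rfl⟩).of_nonneg_of_le
    (hmeas.sub_const _).aestronglyMeasurable (fun ω => sub_nonneg.2 (hy _)) fun ω => ?_
  rw [weightedIterate_eq_centerMass]
  exact (hconv.avg.convexOn.add_const (-P.avg y)).map_centerMass_le hweight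
    (Finset.sum_pos (fun t _ => by positivity) ⟨0, Finset.mem_range.2 hn⟩) fun _ _ => Set.mem_univ _

variable [NeZero M]

theorem integrable_avg_expect_sub (hz : P.IsSampling ν z) (hsmooth : P.SecondOrderSmooth H)
    (hH : 0 < H) {y : Vec d} (hy : y ∈ P.optima) {t : ℕ}
    (hdist : Integrable (fun ω => ‖𝔼 m, P.regularizedIterate η μ K z t ω m - y‖ ^ 2) ν) :
    Integrable (fun ω => P.avg (𝔼 m, P.regularizedIterate η μ K z t ω m) - P.avg y) ν := by
  have hmean := continuous_expect.measurable.comp (hz.measurable_regularizedIterate η μ K t)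
  refine (hdist.const_mul (H / 2)).mono'
    ((continuous_avg.measurable.comp hmean).sub_const _).aestronglyMeasurable
    (.of_forall fun ω => ?_)
  rw [Real.norm_of_nonneg (sub_nonneg.2 (hy _))]
  exact hsmooth.avg.sub_le_of_forall_le hH hy _

variable [IsProbabilityMeasure ν]

theorem hasIntegralLE_dispersion (hz : P.IsSampling ν z) (hconv : P.Convex)
    (hsmooth : P.SecondOrderSmooth H) (hnoise : P.BoundedSecondMoment σ₂)
    (hhet : ∀ m n x, ‖∇ (P.F m) x - ∇ (P.F n) x‖ ≤ G) (hK : 0 < K) (hH : 0 < H) (hη : 0 ≤ η)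
    (hμ : 0 ≤ μ) (hημ : η * μ ≤ 1 / 2) (hηH : η * H ≤ 1) (t : ℕ) :
    HasIntegralLE (fun ω => dispersion (P.regularizedIterate η μ K z t ω))
      (η ^ 2 * driftSecondMoment K G σ₂) ν := by
  refine (hz.hasIntegralLE_of_consensus_zero_of_one_add_inv_pow (j := 1) hK
    continuous_dispersion.measurable dispersion_nonneg dispersion_const
    (p := (1 + K) * (η * G) ^ 2 + η ^ 2 * σ₂ ^ 2) (by positivity) (fun x => ?_) t).mono ?_
  · rw [pow_one]
    exact hasIntegralLE_dispersion_localStep hconv hsmooth hnoise hhet hH hη hμ hημ hηH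
      (Nat.cast_pos.2 hK) x
  · unfold driftSecondMoment
    exact le_of_eq (by ring)

theorem hasIntegralLE_dispersion_sq (hz : P.IsSampling ν z) (hconv : P.Convex)
    (hsmooth : P.SecondOrderSmooth H) (hnoise₂ : P.BoundedSecondMoment σ₂)
    (hnoise₄ : P.BoundedFourthMoment σ₄) (hhet : ∀ m n x, ‖∇ (P.F m) x - ∇ (P.F n) x‖ ≤ G)
    (hK : 0 < K) (hH : 0 < H) (hη : 0 ≤ η) (hμ : 0 ≤ μ) (hημ : η * μ ≤ 1 / 2)
    (hηH : η * H ≤ 1) (t : ℕ) :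
    HasIntegralLE (fun ω => dispersion (P.regularizedIterate η μ K z t ω) ^ 2)
      (η ^ 4 * driftFourthMoment K G σ₂ σ₄) ν := by
  refine (hz.hasIntegralLE_of_consensus_zero_of_one_add_inv_pow (j := 3) hK
    (φ := fun x => dispersion x ^ 2) (continuous_dispersion.measurable.pow_const 2)
    (fun x => sq_nonneg _) (fun c => by rw [dispersion_const, zero_pow two_ne_zero])
    (by positivity) (hasIntegralLE_dispersion_localStep_sq hconv hsmooth hnoise₂ hnoise₄ hhet hH
      hη hμ hημ hηH (Nat.cast_pos.2 hK)) t).mono ?_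
  unfold driftFourthMoment
  exact le_of_eq (by ring)

theorem hasIntegralLE_norm_expect_sub_sq_succ (hz : P.IsSampling ν z) (hconv : P.Convex)
    (hsmooth₂ : P.SecondOrderSmooth H) (hsmooth₃ : P.ThirdOrderSmooth Q)
    (hnoise : P.BoundedSecondMoment σ₂) (hhet : P.SecondOrderHeterogeneity τ) (hH : 0 < H)
    (hη : 0 < η) (hμ : 0 < μ) (hημ : η * μ ≤ 1 / 4) (hηH : 8 * (η * H) ≤ 1) {y : Vec d}
    (hy : y ∈ P.optima) {t : ℕ}
    (hdisp : HasIntegralLE (fun ω => dispersion (P.regularizedIterate η μ K z t ω)) v₂ ν)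
    (hdisp_sq : HasIntegralLE (fun ω => dispersion (P.regularizedIterate η μ K z t ω) ^ 2) v₄ ν)
    (hdist : Integrable (fun ω => ‖𝔼 m, P.regularizedIterate η μ K z t ω m - y‖ ^ 2) ν) :
    HasIntegralLE (fun ω => ‖𝔼 m, P.regularizedIterate η μ K z (t + 1) ω m - y‖ ^ 2)
      ((1 - η * μ / 2) * ∫ ω, ‖𝔼 m, P.regularizedIterate η μ K z t ω m - y‖ ^ 2 ∂ν
        - η * ∫ ω, P.avg (𝔼 m, P.regularizedIterate η μ K z t ω m) - P.avg y ∂ν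
        + (3 * η / μ * (2 * τ ^ 2 * v₂ + 2 * Q ^ 2 * v₄)
          + (η * μ * ‖y‖ ^ 2 + η ^ 2 * (σ₂ ^ 2 / M)))) ν := by
  simp only [expect_regularizedIterate_succ]
  have hmean : Measurable fun x : Fin M → Vec d => 𝔼 m, x m := continuous_expect.measurable
  have hdisp_meas : Measurable (dispersion : (Fin M → Vec d) → ℝ) :=
    continuous_dispersion.measurable
  have hgap_meas : Measurable fun x : Fin M → Vec d => P.avg (𝔼 m, x m) :=
    continuous_avg.measurable.comp hmean
  have hbias := ((hdisp.const_mul (c := 2 * τ ^ 2) (by positivity)).add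
    (hdisp_sq.const_mul (c := 2 * Q ^ 2) (by positivity))).const_mul
      (show 0 ≤ 3 * η / μ by positivity)
  have hcontract := (HasIntegralLE.const_mul ⟨hdist, le_rfl⟩
    (show 0 ≤ 1 - η * μ / 2 by linarith)).sub_const_mul
      (hz.integrable_avg_expect_sub hsmooth₂ hH hy hdist) η
  exact hz.hasIntegralLE_localStep (φ := fun x => ‖𝔼 m, x m - y‖ ^ 2) (by fun_prop)
    (fun x => sq_nonneg _) (by fun_prop)
    (hasIntegralLE_norm_expect_localStep_sub_sq hconv hsmooth₂ hsmooth₃ hnoise hhet hH hη hμ hημ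
      hηH hy) (hcontract.add (hbias.add (.const _)))

theorem hasIntegralLE_avg_weightedIterate_sub_of_dispersion (hz : P.IsSampling ν z)
    (hconv : P.Convex) (hsmooth₂ : P.SecondOrderSmooth H) (hsmooth₃ : P.ThirdOrderSmooth Q)
    (hnoise : P.BoundedSecondMoment σ₂) (hhet : P.SecondOrderHeterogeneity τ) (hK : 0 < K)
    (hR : 0 < R) (hH : 0 < H) (hη : 0 < η) (hμ : 0 < μ) (hημ : η * μ ≤ 1 / 4)
    (hηH : 8 * (η * H) ≤ 1) {y : Vec d} (hy : y ∈ P.optima)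
    (hdisp : ∀ t, HasIntegralLE (fun ω => dispersion (P.regularizedIterate η μ K z t ω)) v₂ ν)
    (hdisp_sq : ∀ t,
      HasIntegralLE (fun ω => dispersion (P.regularizedIterate η μ K z t ω) ^ 2) v₄ ν) :
    HasIntegralLE (fun ω => P.avg ((P.regularize μ).weightedIterate η μ K R fun t m => z t m ω)
        - P.avg y)
      (‖y‖ ^ 2 / (η * (K * R)) + (3 / μ * (2 * τ ^ 2 * v₂ + 2 * Q ^ 2 * v₄)
        + (μ * ‖y‖ ^ 2 + η * (σ₂ ^ 2 / M)))) ν := by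
  have hstep := fun t => hz.hasIntegralLE_norm_expect_sub_sq_succ hconv hsmooth₂ hsmooth₃ hnoise
    hhet hH hη hμ hημ hηH hy (hdisp t) (hdisp_sq t)
  have hstart : ∀ ω, 𝔼 m, P.regularizedIterate η μ K z 0 ω m = 0 := fun _ =>
    Finset.expect_const_zero _
  have hdist : ∀ t,
      Integrable (fun ω => ‖𝔼 m, P.regularizedIterate η μ K z t ω m - y‖ ^ 2) ν := fun t => by
    induction t with
    | zero => simp only [hstart, integrable_const]
    | succ t ih => exact (hstep t ih).integrable
  have hn : 0 < K * R := Nat.mul_pos hK hR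
  refine (hz.hasIntegralLE_avg_weightedIterate_sub hconv (by linarith) hy hn fun t =>
    hz.integrable_avg_expect_sub hsmooth₂ hH hy (hdist t)).mono ?_
  refine (centerMass_pow_le_of_contraction
    (D := fun t => ∫ ω, ‖𝔼 m, P.regularizedIterate η μ K z t ω m - y‖ ^ 2 ∂ν) (by linarith)
    (sub_le_self _ (by positivity)) hη (fun t => integral_nonneg fun ω => sq_nonneg _)
    (fun t => (hstep t (hdist t)).integral_le) hn).trans_eq ?_
  simp only [hstart, zero_sub, norm_neg, integral_const, probReal_univ, one_smul, Nat.cast_mul]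
  field_simp

end FedProblem.IsSampling

/-- The terms of the convergence rate of local SGD due to the second-order heterogeneity `τ`. -/
noncomputable def secondOrderRate (K R H B τ ζ σ₂ : ℝ) : ℝ :=
  τ ^ (1 / 2 : ℝ) * H ^ (1 / 2 : ℝ) * ζ ^ (1 / 2 : ℝ) * B ^ (3 / 2 : ℝ) / R ^ (1 / 2 : ℝ)
    + τ ^ (1 / 2 : ℝ) * σ₂ ^ (1 / 2 : ℝ) * B ^ (3 / 2 : ℝ) / (K ^ (1 / 4 : ℝ) * R ^ (1 / 2 : ℝ))

/-- The terms of the convergence rate of local SGD due to the third-order smoothness `Q`. -/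
noncomputable def thirdOrderRate (K R H B Q ζ σ₂ σ₄ : ℝ) : ℝ :=
  Q ^ (1 / 3 : ℝ) * B ^ (5 / 3 : ℝ) * H ^ (2 / 3 : ℝ) * ζ ^ (2 / 3 : ℝ) / R ^ (2 / 3 : ℝ)
    + Q ^ (1 / 3 : ℝ) * B ^ (5 / 3 : ℝ) * σ₂ ^ (2 / 3 : ℝ) / (K ^ (1 / 3 : ℝ) * R ^ (2 / 3 : ℝ))
    + Q ^ (1 / 3 : ℝ) * B ^ (5 / 3 : ℝ) * σ₄ ^ (2 / 3 : ℝ) / (K ^ (1 / 2 : ℝ) * R ^ (2 / 3 : ℝ))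

/-- The convergence rate of local SGD, up to constants: the optimization error of `K R` steps, the
drift of the local iterates, and the noise of the averaged gradient. -/
noncomputable def localSGDRate (M K R H B Q τ ζ σ₂ σ₄ : ℝ) : ℝ :=
  H * B ^ 2 / (K * R) + secondOrderRate K R H B τ ζ σ₂ + thirdOrderRate K R H B Q ζ σ₂ σ₄
    + σ₂ * B / √(M * K * R)

theorem rpow_pow_eq_pow {a p : ℝ} {n m : ℕ} (ha : 0 ≤ a) (h : p * n = m) : (a ^ p) ^ n = a ^ m := by
  rw [← Real.rpow_mul_natCast ha, h, Real.rpow_natCast]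

theorem le_sq_mul_pow_of_pow_eq {x B T μ : ℝ} {k : ℕ} (hB : 0 < B) (hT : 0 ≤ T)
    (hTμ : T ≤ B ^ 2 * μ) (h : T ^ (k + 1) = x * B ^ (2 * k)) : x ≤ B ^ 2 * μ ^ (k + 1) := by
  have hB_pow : 0 < B ^ (2 * k) := by positivity
  refine le_of_mul_le_mul_right ?_ hB_pow
  calc x * B ^ (2 * k) = T ^ (k + 1) := h.symm
    _ ≤ (B ^ 2 * μ) ^ (k + 1) := pow_le_pow_left₀ hT hTμ _
    _ = B ^ 2 * μ ^ (k + 1) * B ^ (2 * k) := by ring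

section ParameterChoice

variable {M K R H B Q τ ζ σ₂ σ₄ μ η b : ℝ}

theorem secondOrderRate_nonneg (hK : 0 ≤ K) (hR : 0 ≤ R) (hH : 0 ≤ H) (hB : 0 ≤ B) (hτ : 0 ≤ τ)
    (hζ : 0 ≤ ζ) (hσ₂ : 0 ≤ σ₂) : 0 ≤ secondOrderRate K R H B τ ζ σ₂ := by
  unfold secondOrderRate
  positivity

theorem thirdOrderRate_nonneg (hK : 0 ≤ K) (hR : 0 ≤ R) (hH : 0 ≤ H) (hB : 0 ≤ B) (hQ : 0 ≤ Q)
    (hζ : 0 ≤ ζ) (hσ₂ : 0 ≤ σ₂) (hσ₄ : 0 ≤ σ₄) : 0 ≤ thirdOrderRate K R H B Q ζ σ₂ σ₄ := by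
  unfold thirdOrderRate
  positivity

theorem le_of_secondOrderRate_le (hK : 0 ≤ K) (hR : 0 ≤ R) (hH : 0 ≤ H) (hB : 0 < B)
    (hτ : 0 ≤ τ) (hζ : 0 ≤ ζ) (hσ₂ : 0 ≤ σ₂)
    (hrate : secondOrderRate K R H B τ ζ σ₂ ≤ B ^ 2 * μ) :
    τ ^ 2 * H ^ 2 * ζ ^ 2 / R ^ 2 ≤ B ^ 2 * μ ^ 4 ∧
      τ ^ 2 * σ₂ ^ 2 / (K * R ^ 2) ≤ B ^ 2 * μ ^ 4 := by
  unfold secondOrderRate at hrate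
  constructor
  · refine le_sq_mul_pow_of_pow_eq (k := 3) hB (by positivity)
      ((le_add_of_nonneg_right (by positivity)).trans hrate) ?_
    simp only [div_pow, mul_pow]
    rw [rpow_pow_eq_pow hτ (m := 2) (by norm_num), rpow_pow_eq_pow hH (m := 2) (by norm_num),
      rpow_pow_eq_pow hζ (m := 2) (by norm_num), rpow_pow_eq_pow hB.le (m := 6) (by norm_num),
      rpow_pow_eq_pow hR (m := 2) (by norm_num)]
    ring
  · refine le_sq_mul_pow_of_pow_eq (k := 3) hB (by positivity)
      ((le_add_of_nonneg_left (by positivity)).trans hrate) ?_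
    simp only [div_pow, mul_pow]
    rw [rpow_pow_eq_pow hτ (m := 2) (by norm_num), rpow_pow_eq_pow hσ₂ (m := 2) (by norm_num),
      rpow_pow_eq_pow hB.le (m := 6) (by norm_num), rpow_pow_eq_pow hK (m := 1) (by norm_num),
      rpow_pow_eq_pow hR (m := 2) (by norm_num)]
    ring

theorem le_of_thirdOrderRate_le (hK : 0 ≤ K) (hR : 0 ≤ R) (hH : 0 ≤ H) (hB : 0 < B) (hQ : 0 ≤ Q)
    (hζ : 0 ≤ ζ) (hσ₂ : 0 ≤ σ₂) (hσ₄ : 0 ≤ σ₄)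
    (hrate : thirdOrderRate K R H B Q ζ σ₂ σ₄ ≤ B ^ 2 * μ) :
    Q ^ 2 * H ^ 4 * ζ ^ 4 / R ^ 4 ≤ B ^ 2 * μ ^ 6 ∧
      Q ^ 2 * σ₂ ^ 4 / (K ^ 2 * R ^ 4) ≤ B ^ 2 * μ ^ 6 ∧
      Q ^ 2 * σ₄ ^ 4 / (K ^ 3 * R ^ 4) ≤ B ^ 2 * μ ^ 6 := by
  unfold thirdOrderRate at hrate
  have hQ_pow := rpow_pow_eq_pow hQ (p := 1 / 3) (n := 6) (m := 2) (by norm_num)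
  have hB_pow := rpow_pow_eq_pow hB.le (p := 5 / 3) (n := 6) (m := 10) (by norm_num)
  have hR_pow := rpow_pow_eq_pow hR (p := 2 / 3) (n := 6) (m := 4) (by norm_num)
  refine ⟨?_, ?_, ?_⟩
  · rw [add_assoc] at hrate
    refine le_sq_mul_pow_of_pow_eq (k := 5) hB (by positivity)
      ((le_add_of_nonneg_right (by positivity)).trans hrate) ?_
    simp only [div_pow, mul_pow]
    rw [hQ_pow, hB_pow, hR_pow, rpow_pow_eq_pow hH (m := 4) (by norm_num),
      rpow_pow_eq_pow hζ (m := 4) (by norm_num)]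
    ring
  · rw [add_right_comm] at hrate
    refine le_sq_mul_pow_of_pow_eq (k := 5) hB (by positivity)
      ((le_add_of_nonneg_left (by positivity)).trans hrate) ?_
    simp only [div_pow, mul_pow]
    rw [hQ_pow, hB_pow, hR_pow, rpow_pow_eq_pow hσ₂ (m := 4) (by norm_num),
      rpow_pow_eq_pow hK (m := 2) (by norm_num)]
    ring
  · refine le_sq_mul_pow_of_pow_eq (k := 5) hB (by positivity)
      ((le_add_of_nonneg_left (by positivity)).trans hrate) ?_
    simp only [div_pow, mul_pow]
    rw [hQ_pow, hB_pow, hR_pow, rpow_pow_eq_pow hσ₄ (m := 4) (by norm_num),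
      rpow_pow_eq_pow hK (m := 3) (by norm_num)]
    ring

theorem secondOrder_bias_le (hK : 1 ≤ K) (hR : 0 < R) (hH : 0 ≤ H) (hB : 0 < B) (hτ : 0 ≤ τ)
    (hζ : 0 ≤ ζ) (hσ₂ : 0 ≤ σ₂) (hμ : 0 < μ) (hη : η = 1 / (8 * μ * (K * R)))
    (hrate : secondOrderRate K R H B τ ζ σ₂ ≤ B ^ 2 * μ) :
    3 / μ * (2 * τ ^ 2 * (η ^ 2 * driftSecondMoment K (H * ζ) σ₂)) ≤ B ^ 2 * μ := by
  have hK_pos : 0 < K := by linarith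
  obtain ⟨hhet, hnoise⟩ := le_of_secondOrderRate_le hK_pos.le hR.le hH hB hτ hζ hσ₂ hrate
  calc 3 / μ * (2 * τ ^ 2 * (η ^ 2 * driftSecondMoment K (H * ζ) σ₂))
      ≤ 3 / μ * (2 * τ ^ 2 * (η ^ 2 * (3 * K * ((K + K) * (H * ζ) ^ 2 + σ₂ ^ 2)))) := by
        unfold driftSecondMoment
        gcongr
    _ = (36 * (τ ^ 2 * H ^ 2 * ζ ^ 2 / R ^ 2) + 18 * (τ ^ 2 * σ₂ ^ 2 / (K * R ^ 2)))
          / (64 * μ ^ 3) := by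
        rw [hη]
        field_simp
        ring
    _ ≤ 64 * (B ^ 2 * μ ^ 4) / (64 * μ ^ 3) := by
        have : 0 ≤ B ^ 2 * μ ^ 4 := by positivity
        gcongr
        linarith
    _ = B ^ 2 * μ := by field_simp

theorem thirdOrder_bias_le (hK : 1 ≤ K) (hR : 0 < R) (hH : 0 ≤ H) (hB : 0 < B) (hQ : 0 ≤ Q)
    (hζ : 0 ≤ ζ) (hσ₂ : 0 ≤ σ₂) (hσ₄ : 0 ≤ σ₄) (hμ : 0 < μ) (hη : η = 1 / (8 * μ * (K * R)))
    (hrate : thirdOrderRate K R H B Q ζ σ₂ σ₄ ≤ B ^ 2 * μ) :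
    3 / μ * (2 * Q ^ 2 * (η ^ 4 * driftFourthMoment K (H * ζ) σ₂ σ₄)) ≤ 5 * (B ^ 2 * μ) := by
  have hK_pos : 0 < K := by linarith
  obtain ⟨hhet, hnoise₂, hnoise₄⟩ :=
    le_of_thirdOrderRate_le hK_pos.le hR.le hH hB hQ hζ hσ₂ hσ₄ hrate
  have hsq : ((K + K) * (H * ζ) ^ 2 + 5 * σ₂ ^ 2) ^ 2
      ≤ 8 * K ^ 2 * H ^ 4 * ζ ^ 4 + 50 * σ₂ ^ 4 :=
    (add_sq_le (a := (K + K) * (H * ζ) ^ 2)).trans_eq (by ring)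
  calc 3 / μ * (2 * Q ^ 2 * (η ^ 4 * driftFourthMoment K (H * ζ) σ₂ σ₄))
      ≤ 3 / μ * (2 * Q ^ 2 * (η ^ 4 * (27 * K * ((K + K)
          * ((K + K) * (H * ζ) ^ 2 + 5 * σ₂ ^ 2) ^ 2 + 2 * σ₄ ^ 4)))) := by
        unfold driftFourthMoment
        gcongr
    _ ≤ 3 / μ * (2 * Q ^ 2 * (η ^ 4 * (27 * K * ((K + K)
          * (8 * K ^ 2 * H ^ 4 * ζ ^ 4 + 50 * σ₂ ^ 4) + 2 * σ₄ ^ 4)))) := by gcongr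
    _ = (2592 * (Q ^ 2 * H ^ 4 * ζ ^ 4 / R ^ 4) + 16200 * (Q ^ 2 * σ₂ ^ 4 / (K ^ 2 * R ^ 4))
          + 324 * (Q ^ 2 * σ₄ ^ 4 / (K ^ 3 * R ^ 4))) / (4096 * μ ^ 5) := by
        rw [hη]
        field_simp
        ring
    _ ≤ 5 * (4096 * (B ^ 2 * μ ^ 6)) / (4096 * μ ^ 5) := by
        have : 0 ≤ B ^ 2 * μ ^ 6 := by positivity
        gcongr
        linarith
    _ = 5 * (B ^ 2 * μ) := by field_simp

theorem noise_variance_le (hM : 0 < M) (hK : 0 < K) (hR : 0 < R) (hB : 0 < B) (hσ₂ : 0 ≤ σ₂)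
    (hμ : 0 < μ) (hη : η = 1 / (8 * μ * (K * R))) (hrate : σ₂ * B / √(M * K * R) ≤ B ^ 2 * μ) :
    η * (σ₂ ^ 2 / M) ≤ B ^ 2 * μ / 8 := by
  have hvar : σ₂ ^ 2 / (M * K * R) ≤ B ^ 2 * μ ^ 2 := by
    refine le_sq_mul_pow_of_pow_eq (k := 1) hB (by positivity) hrate ?_
    rw [div_pow, mul_pow, Real.sq_sqrt (by positivity)]
    ring
  calc η * (σ₂ ^ 2 / M) = σ₂ ^ 2 / (M * K * R) / (8 * μ) := by
        rw [hη]
        field_simp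
    _ ≤ B ^ 2 * μ ^ 2 / (8 * μ) := by gcongr
    _ = B ^ 2 * μ / 8 := by field_simp

theorem excess_bound_le_of_localSGDRate_eq (hM : 0 < M) (hK : 1 ≤ K) (hR : 0 < R) (hH : 0 < H)
    (hB : 0 < B) (hQ : 0 ≤ Q) (hτ : 0 ≤ τ) (hζ : 0 ≤ ζ) (hσ₂ : 0 ≤ σ₂) (hσ₄ : 0 ≤ σ₄)
    (hμ : 0 < μ) (hη : η = 1 / (8 * μ * (K * R))) (hb : 0 ≤ b) (hbB : b ≤ B)
    (hrate : localSGDRate M K R H B Q τ ζ σ₂ σ₄ = B ^ 2 * μ) :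
    b ^ 2 / (η * (K * R)) + (3 / μ * (2 * τ ^ 2 * (η ^ 2 * driftSecondMoment K (H * ζ) σ₂)
        + 2 * Q ^ 2 * (η ^ 4 * driftFourthMoment K (H * ζ) σ₂ σ₄))
        + (μ * b ^ 2 + η * (σ₂ ^ 2 / M)))
      ≤ 16 * localSGDRate M K R H B Q τ ζ σ₂ σ₄ := by
  have hK_pos : 0 < K := by linarith
  have hopt_nonneg : 0 ≤ H * B ^ 2 / (K * R) := by positivity
  have hsecond_nonneg := secondOrderRate_nonneg hK_pos.le hR.le hH.le hB.le hτ hζ hσ₂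
  have hthird_nonneg := thirdOrderRate_nonneg hK_pos.le hR.le hH.le hB.le hQ hζ hσ₂ hσ₄
  have hnoise_nonneg : 0 ≤ σ₂ * B / √(M * K * R) := by positivity
  have hsplit := hrate
  unfold localSGDRate at hsplit
  have hsecond := secondOrder_bias_le hK hR hH.le hB hτ hζ hσ₂ hμ hη (by linarith)
  have hthird := thirdOrder_bias_le hK hR hH.le hB hQ hζ hσ₂ hσ₄ hμ hη (by linarith)
  have hnoise := noise_variance_le hM hK_pos hR hB hσ₂ hμ hη (by linarith)
  have hinit : b ^ 2 / (η * (K * R)) = 8 * (b ^ 2 * μ) := by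
    rw [hη]
    field_simp
  have hnorm : b ^ 2 * μ ≤ B ^ 2 * μ := by gcongr
  rw [hrate, hinit, mul_add (3 / μ)]
  linarith [mul_nonneg (sq_nonneg B) hμ.le]

end ParameterChoice

theorem localSGDRate_pos {M K R H B Q τ ζ σ₂ σ₄ : ℝ} (hK : 0 < K) (hR : 0 < R) (hH : 0 < H)
    (hB : 0 < B) (hQ : 0 ≤ Q) (hτ : 0 ≤ τ) (hζ : 0 ≤ ζ) (hσ₂ : 0 ≤ σ₂) (hσ₄ : 0 ≤ σ₄) :
    0 < localSGDRate M K R H B Q τ ζ σ₂ σ₄ := by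
  have hsecond := secondOrderRate_nonneg hK.le hR.le hH.le hB.le hτ hζ hσ₂
  have hthird := thirdOrderRate_nonneg hK.le hR.le hH.le hB.le hQ hζ hσ₂ hσ₄
  unfold localSGDRate
  positivity

theorem le_localSGDRate {M K R H B Q τ ζ σ₂ σ₄ : ℝ} (hK : 0 ≤ K) (hR : 0 ≤ R) (hH : 0 ≤ H)
    (hB : 0 ≤ B) (hQ : 0 ≤ Q) (hτ : 0 ≤ τ) (hζ : 0 ≤ ζ) (hσ₂ : 0 ≤ σ₂) (hσ₄ : 0 ≤ σ₄) :
    H * B ^ 2 / (K * R) ≤ localSGDRate M K R H B Q τ ζ σ₂ σ₄ := by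
  have hsecond := secondOrderRate_nonneg hK hR hH hB hτ hζ hσ₂
  have hthird := thirdOrderRate_nonneg hK hR hH hB hQ hζ hσ₂ hσ₄
  have hnoise : 0 ≤ σ₂ * B / √(M * K * R) := by positivity
  unfold localSGDRate
  linarith

theorem FedProblem.IsSampling.hasIntegralLE_avg_weightedIterate_sub_of_localSGDRate_eq {d M : ℕ}
    [NeZero M] {Z Ω : Type*} [MeasurableSpace Z] {P : FedProblem d M Z} {z : ℕ → Fin M → Ω → Z}
    [MeasurableSpace Ω] {ν : Measure Ω} [IsProbabilityMeasure ν] {K R : ℕ}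
    {H B Q τ ζ σ₂ σ₄ η μ : ℝ} (hz : P.IsSampling ν z) (hconv : P.Convex)
    (hsmooth₂ : P.SecondOrderSmooth H) (hsmooth₃ : P.ThirdOrderSmooth Q)
    (hnoise₂ : P.BoundedSecondMoment σ₂) (hnoise₄ : P.BoundedFourthMoment σ₄)
    (hhet₂ : P.SecondOrderHeterogeneity τ) (hhet₁ : P.UniformFirstOrderHeterogeneity H ζ)
    (hK : 0 < K) (hR : 0 < R) (hH : 0 < H) (hB : 0 < B) (hQ : 0 ≤ Q) (hτ : 0 ≤ τ) (hζ : 0 ≤ ζ)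
    (hσ₂ : 0 ≤ σ₂) (hσ₄ : 0 ≤ σ₄) (hη : η = 1 / (8 * μ * (K * R)))
    (hrate : localSGDRate M K R H B Q τ ζ σ₂ σ₄ = B ^ 2 * μ) {y : Vec d} (hy : y ∈ P.optima)
    (hyB : ‖y‖ ≤ B) :
    HasIntegralLE (fun ω => P.avg ((P.regularize μ).weightedIterate η μ K R fun t m => z t m ω)
      - P.avg y) (16 * localSGDRate M K R H B Q τ ζ σ₂ σ₄) ν := by
  have hK_one : (1 : ℝ) ≤ K := Nat.one_le_cast.2 hK
  have hR_one : (1 : ℝ) ≤ R := Nat.one_le_cast.2 hR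
  have hK_pos : (0 : ℝ) < K := by positivity
  have hR_pos : (0 : ℝ) < R := by positivity
  have hM_pos : (0 : ℝ) < M := Nat.cast_pos.2 (NeZero.pos M)
  have hμ : 0 < μ := pos_of_mul_pos_right
    (hrate ▸ localSGDRate_pos hK_pos hR_pos hH hB hQ hτ hζ hσ₂ hσ₄) (sq_nonneg B)
  have hη_pos : 0 < η := hη ▸ by positivity
  have hημ : η * μ * (K * R) = 1 / 8 := by
    rw [hη]
    field_simp
  have hημ_le : η * μ ≤ 1 / 8 :=
    hημ ▸ le_mul_of_one_le_right (by positivity) (one_le_mul_of_one_le_of_one_le hK_one hR_one)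
  have hHμ : H ≤ μ * (K * R) := by
    have hopt := (le_localSGDRate hK_pos.le hR_pos.le hH.le hB.le hQ hτ hζ hσ₂ hσ₄).trans_eq hrate
    rw [div_le_iff₀ (by positivity), mul_comm, mul_assoc] at hopt
    exact le_of_mul_le_mul_left hopt (by positivity)
  have hηH : 8 * (η * H) ≤ 1 := by
    have := mul_le_mul_of_nonneg_left hHμ hη_pos.le
    linarith
  refine (hz.hasIntegralLE_avg_weightedIterate_sub_of_dispersion hconv hsmooth₂ hsmooth₃ hnoise₂
    hhet₂ hK hR hH hη_pos hμ (by linarith) hηH hy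
    (hz.hasIntegralLE_dispersion hconv hsmooth₂ hnoise₂ hhet₁ hK hH hη_pos.le hμ.le
      (by linarith) (by linarith [mul_pos hη_pos hH]))
    (hz.hasIntegralLE_dispersion_sq hconv hsmooth₂ hnoise₂ hnoise₄ hhet₁ hK hH hη_pos.le hμ.le
      (by linarith) (by linarith [mul_pos hη_pos hH]))).mono ?_
  exact excess_bound_le_of_localSGDRate_eq hM_pos hK_one hR_pos hH hB hQ hτ hζ hσ₂ hσ₄ hμ hη
    (norm_nonneg y) hyB hrate

theorem mainTheorem6_general {M K R : ℕ} {H B Q τ ζ σ₂ σ₄ : ℝ} (hM : 0 < M) (hK : 0 < K)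
    (hR : 0 < R) (hH : 0 < H) (hB : 0 < B) (hQ : 0 ≤ Q) (hτ : 0 ≤ τ) (hζ : 0 ≤ ζ)
    (hσ₂ : 0 ≤ σ₂) (hσ₄ : 0 ≤ σ₄) :
    ∃ η μ : ℝ, 0 < η ∧ 0 < μ ∧ η * μ < 2 ∧
      ∀ (d : ℕ) (Z : Type*) [MeasurableSpace Z] (P : FedProblem d M Z),
        P.Convex → P.SecondOrderSmooth H → P.ThirdOrderSmooth Q →
        P.BoundedSecondMoment σ₂ → P.BoundedFourthMoment σ₄ → (∃ x ∈ P.optima, ‖x‖ ≤ B) →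
        P.SecondOrderHeterogeneity τ → P.UniformFirstOrderHeterogeneity H ζ →
      ∀ (Ω : Type*) [MeasurableSpace Ω] (ν : Measure Ω) [IsProbabilityMeasure ν]
        (z : ℕ → Fin M → Ω → Z), P.IsSampling ν z →
        Integrable (fun ω =>
          P.avg ((P.regularize μ).weightedIterate η μ K R fun t m => z t m ω)) ν ∧
        ∀ xstar ∈ P.optima,
          (∫ ω, P.avg ((P.regularize μ).weightedIterate η μ K R fun t m => z t m ω) ∂ν)
            - P.avg xstar ≤ 16 * localSGDRate M K R H B Q τ ζ σ₂ σ₄ := by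
  have : NeZero M := ⟨hM.ne'⟩
  have hKR : 1 ≤ (K : ℝ) * R := mod_cast Nat.mul_pos hK hR
  set ρ := localSGDRate M K R H B Q τ ζ σ₂ σ₄
  have hρ_pos : 0 < ρ :=
    localSGDRate_pos (Nat.cast_pos.2 hK) (Nat.cast_pos.2 hR) hH hB hQ hτ hζ hσ₂ hσ₄
  have hμ : 0 < ρ / B ^ 2 := by positivity
  refine ⟨1 / (8 * (ρ / B ^ 2) * (K * R)), ρ / B ^ 2, by positivity, hμ, ?_, ?_⟩
  · rw [div_mul_eq_mul_div, one_mul, div_lt_iff₀ (by positivity)]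
    linarith [le_mul_of_one_le_right hμ.le hKR]
  intro d Z _ P hconv hsmooth₂ hsmooth₃ hnoise₂ hnoise₄ ⟨y, hy, hyB⟩ hhet₂ hhet₁ Ω _ ν _ z hz
  have hgap := hz.hasIntegralLE_avg_weightedIterate_sub_of_localSGDRate_eq hconv hsmooth₂ hsmooth₃
    hnoise₂ hnoise₄ hhet₂ hhet₁ hK hR hH hB hQ hτ hζ hσ₂ hσ₄ rfl
    (mul_div_cancel₀ ρ (pow_ne_zero 2 hB.ne')).symm hy hyB
  have hint := (hgap.integrable.add (integrable_const (P.avg y))).congr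
    (.of_forall fun ω => sub_add_cancel _ _)
  refine ⟨hint, fun xstar hxstar => ?_⟩
  have hmin : P.avg xstar = P.avg y := le_antisymm (hxstar y) (hy xstar)
  have hle := hgap.integral_le
  rwa [integral_sub hint (integrable_const _), integral_const, probReal_univ, one_smul, ← hmin]
    at hle

theorem mainTheorem6 :
    ∃ c C : ℝ, 0 < c ∧ 0 < C ∧
    ∀ (M K R : ℕ) (H B Q τ ζ σ₂ σ₄ : ℝ),
      0 < M → 0 < K → 0 < R → 0 < H → 0 < B →
      0 ≤ Q → 0 ≤ τ → 0 ≤ ζ → 0 ≤ σ₂ → 0 ≤ σ₄ →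
      c * (1 / (K : ℝ) + σ₂ ^ 2 / (H ^ 2 * B ^ 2 * M * K) + τ * ζ / (B * H)
          + Q * ζ ^ 2 / (H * B) + τ * σ₂ / (H ^ 2 * B * √(K : ℝ))
          + σ₂ * Q ^ (1 / 2 : ℝ) / (H ^ (3 / 2 : ℝ) * √(B * K))
          + Q ^ (1 / 2 : ℝ) * σ₄ / (H ^ (3 / 2 : ℝ) * √B * (K : ℝ) ^ (3 / 4 : ℝ))) ≤ (R : ℝ) →
      ∃ η μ : ℝ, 0 < η ∧ 0 < μ ∧ η * μ < 2 ∧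
      ∀ (d : ℕ) (Z : Type*) [MeasurableSpace Z] (P : FedProblem d M Z),
        P.Convex → P.SecondOrderSmooth H → P.ThirdOrderSmooth Q →
        P.BoundedSecondMoment σ₂ → P.BoundedFourthMoment σ₄ → P.BoundedOptima B →
        P.SecondOrderHeterogeneity τ → P.UniformFirstOrderHeterogeneity H ζ →
      ∀ (Ω : Type*) [MeasurableSpace Ω] (ν : Measure Ω) [IsProbabilityMeasure ν]
        (z : ℕ → Fin M → Ω → Z), P.IsSampling ν z →
      ∀ xhat : Ω → Vec d,
        (∀ ω, xhat ω = (P.regularize μ).weightedIterate η μ K R (fun t m => z t m ω)) →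
        Integrable (fun ω => P.avg (xhat ω)) ν ∧
        ∀ xstar ∈ P.optima,
          (∫ ω, P.avg (xhat ω) ∂ν) - P.avg xstar ≤
            C * (1 + Real.log ((K : ℝ) * R)) *
              (H * B ^ 2 / (K * R)
                + τ ^ (1 / 2 : ℝ) * H ^ (1 / 2 : ℝ) * ζ ^ (1 / 2 : ℝ) * B ^ (3 / 2 : ℝ)
                    / (R : ℝ) ^ (1 / 2 : ℝ)
                + τ ^ (1 / 2 : ℝ) * σ₂ ^ (1 / 2 : ℝ) * B ^ (3 / 2 : ℝ)
                    / ((K : ℝ) ^ (1 / 4 : ℝ) * (R : ℝ) ^ (1 / 2 : ℝ))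
                + Q ^ (1 / 3 : ℝ) * B ^ (5 / 3 : ℝ) * H ^ (2 / 3 : ℝ) * ζ ^ (2 / 3 : ℝ)
                    / (R : ℝ) ^ (2 / 3 : ℝ)
                + Q ^ (1 / 3 : ℝ) * B ^ (5 / 3 : ℝ) * σ₂ ^ (2 / 3 : ℝ)
                    / ((K : ℝ) ^ (1 / 3 : ℝ) * (R : ℝ) ^ (2 / 3 : ℝ))
                + Q ^ (1 / 3 : ℝ) * B ^ (5 / 3 : ℝ) * σ₄ ^ (2 / 3 : ℝ)
                    / ((K : ℝ) ^ (1 / 2 : ℝ) * (R : ℝ) ^ (2 / 3 : ℝ))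
                + σ₂ * B / √((M : ℝ) * K * R)) := by
  refine ⟨1, 16, one_pos, by norm_num, ?_⟩
  intro M K R H B Q τ ζ σ₂ σ₄ hM hK hR hH hB hQ hτ hζ hσ₂ hσ₄ _
  obtain ⟨η, μ, hη, hμ, hημ, hgeneral⟩ :=
    mainTheorem6_general hM hK hR hH hB hQ hτ hζ hσ₂ hσ₄
  refine ⟨η, μ, hη, hμ, hημ, ?_⟩
  intro d Z _ P hconv hsmooth₂ hsmooth₃ hnoise₂ hnoise₄ hoptima hhet₂ hhet₁ Ω _ ν _ z hz xhat hxhat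
  obtain ⟨hint, hgap⟩ := hgeneral d Z P hconv hsmooth₂ hsmooth₃ hnoise₂ hnoise₄ hoptima.2 hhet₂
    hhet₁ Ω ν z hz
  have hlog : 1 ≤ 1 + Real.log ((K : ℝ) * R) :=
    le_add_of_nonneg_right (Real.log_nonneg (mod_cast Nat.mul_pos hK hR))
  simp only [hxhat]
  refine ⟨hint, fun xstar hxstar => (hgap xstar hxstar).trans ?_⟩
  simp only [localSGDRate, secondOrderRate, thirdOrderRate, ← add_assoc]
  gcongr
  linarith
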